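/- Let $n\ge 3$. For a Coxeter system $(W,S)$ with length function $\ell$, the Bruhat order is defined by $u\le v$ iff $v=ut_1\cdots t_r$ for some $r\ge 0$ and reflections $t_i$ (conjugates of elements of $S$) such that the length strictly increases at each step, i.e. $\ell(ut_1\cdots t_{i-1})<\ell(ut_1\cdots t_i)$ for all $i$. For $J\subseteq S$ let $W^J$ be the set of $w\in W$ such that no reduced expression of $w$ ends in an element of $J$ (the minimal-length representatives of the cosets in $W/W_J$), ordered by the restriction of the Bruhat order. (a) Let $(W,S)$ be of type $B_n$ and $J\subseteq S$ with $W_J$ of type $A_{n-1}$ (that is, the Coxeter graph induced on $J$ is of type $A_{n-1}$), and let $(U,T)$ be of type $D_{n+1}$ and $K\subseteq T$ with $U_K$ of type $A_n$. Then $W^J\cong U^K$ as posets. (b) Label the generators so that $S=\{s_1,\dots,s_n\}$ has Coxeter graph the path $s_1-s_2-\cdots-s_n$ with the edge $s_1-s_2$ labelled $4$, and $T=\{t_0,\dots,t_n\}$ has Coxeter graph the path $t_1-t_2-\cdots-t_n$ together with an edge $t_0-t_2$ (no labels), and let $J=\{s_2,\dots,s_n\}$ and $K=\{t_0,t_2,\dots,t_n\}$.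 Then $W_J$ and $U_K$ are of types $A_{n-1}$ and $A_n$. For integers $n\ge k_1>k_2>\dots>k_m\ge 1$ with $m\ge 0$ consider the word $$(s_{k_m}\cdots s_2s_1)(s_{k_{m-1}}\cdots s_2s_1)\cdots(s_{k_1}\cdots s_2s_1),$$ and the word in $T$ obtained from it by replacing each $s_i$ with $i>1$ by $t_i$ and the occurrences of $s_1$, counted from right to left, alternately by $t_1,t_0,t_1,t_0,\dots$. These words are reduced expressions of elements of $W^J$ and of $U^K$ respectively, every element of $W^J$ and every element of $U^K$ is given by exactly one such sequence $(k_1,\dots,k_m)$, and the bijection $W^J\to U^K$ that sends the element of $W^J$ given by $(k_1,\dots,k_m)$ to the element of $U^K$ given by the same sequence is an isomorphism of posets. -/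

import Mathlib

namespace BruhatQuotient

/-- The Coxeter matrix of type `B_n` for the labelling `s_1, …, s_n` of the generators along the
path `s_1 -4- s_2 - s_3 - ⋯ - s_n`. The index `i : Fin n` stands for the generator `s_{i+1}`. -/
def matB (n : ℕ) : CoxeterMatrix (Fin n) where
  M := Matrix.of fun i j : Fin n ↦
    if i = j then 1
    else if ((i : ℕ) = 0 ∧ (j : ℕ) = 1) ∨ ((i : ℕ) = 1 ∧ (j : ℕ) = 0) then 4
    else if (i : ℕ) + 1 = j ∨ (j : ℕ) + 1 = i then 3 else 2
  isSymm := by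
    ext i j
    simp only [Matrix.transpose_apply, Matrix.of_apply]
    grind
  diagonal := by simp
  off_diagonal := by
    intro i j h
    simp only [Matrix.of_apply, if_neg h]
    split_ifs <;> omega

/-- This is Mathlib's matrix of type `B_n` with the labelling reversed. -/
theorem matB_eq_reindex (n : ℕ) :
    matB n = (CoxeterMatrix.B n).reindex Fin.revPerm := by
  ext i j
  simp only [matB, CoxeterMatrix.reindex, CoxeterMatrix.B, Matrix.reindex_apply,
    Matrix.submatrix_apply, Matrix.of_apply, Fin.revPerm_symm, Fin.revPerm_apply, Fin.rev_inj,
    Fin.val_rev]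
  have := i.2
  have := j.2
  split_ifs <;> omega

/-- The Coxeter matrix of type `D_{n+1}` for the labelling `t_0, t_1, …, t_n` of the generators in
which `t_1 - t_2 - ⋯ - t_n` is a path and `t_0` is joined to `t_2` only. The index
`i : Fin (n + 1)` stands for the generator `t_i`. -/
def matD (n : ℕ) : CoxeterMatrix (Fin (n + 1)) where
  M := Matrix.of fun i j : Fin (n + 1) ↦
    if i = j then 1
    else if ((i : ℕ) = 0 ∧ (j : ℕ) = 2) ∨ ((i : ℕ) = 2 ∧ (j : ℕ) = 0) then 3
    else if (1 ≤ (i : ℕ) ∧ (i : ℕ) + 1 = j) ∨ (1 ≤ (j : ℕ) ∧ (j : ℕ) + 1 = i) then 3 else 2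
  isSymm := by
    ext i j
    simp only [Matrix.transpose_apply, Matrix.of_apply]
    grind
  diagonal := by simp
  off_diagonal := by
    intro i j h
    simp only [Matrix.of_apply, if_neg h]
    split_ifs <;> omega

/-- The parabolic subgroup generated by the subset `J` of the generators is of type `A_r`: the
Coxeter graph induced on `J` is the unlabelled path with `r` nodes. -/
def IsTypeA {B : Type*} (M : CoxeterMatrix B) (J : Set B) (r : ℕ) : Prop :=
  ∃ e : J ≃ Fin r, ∀ i j : J, M i j = CoxeterMatrix.A r (e i) (e j)

section Bruhat

variable {B : Type*} {M : CoxeterMatrix B} {W : Type*} [Group W]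

/-- One step `u → u t` of the Bruhat order, with `t` a reflection and `ℓ(u) < ℓ(u t)`. -/
def BruhatStep (cs : CoxeterSystem M W) (u v : W) : Prop :=
  ∃ t : W, cs.IsReflection t ∧ v = u * t ∧ cs.length u < cs.length v

/-- The Bruhat order: `u ≤ v` if `v = u t_1 ⋯ t_n` (`n ≥ 0`) with reflections `t_i` such that the
length increases strictly at each step. -/
def BruhatLE (cs : CoxeterSystem M W) : W → W → Prop :=
  Relation.ReflTransGen (BruhatStep cs)

/-- `w ∈ W^J`: the last generator of any reduced expression of `w` is not in `J`. -/
def IsMinRep (cs : CoxeterSystem M W) (J : Set B) (w : W) : Prop :=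
  ∀ (ω : List B) (j : B), cs.IsReduced (ω ++ [j]) → cs.wordProd (ω ++ [j]) = w → j ∉ J

/-- The set `W^J`, as a type which carries the Bruhat order of `W`. -/
def MinReps (cs : CoxeterSystem M W) (J : Set B) : Type _ := {w : W // IsMinRep cs J w}

theorem BruhatLE.eq_or_length_lt {cs : CoxeterSystem M W} {u v : W} (h : BruhatLE cs u v) :
    u = v ∨ cs.length u < cs.length v := by
  induction h with
  | refl => exact Or.inl rfl
  | tail _ hs ih =>
    obtain ⟨t, _, _, hl⟩ := hs
    rcases ih with rfl | ih
    · exact Or.inr hl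
    · exact Or.inr (ih.trans hl)

instance (cs : CoxeterSystem M W) (J : Set B) : PartialOrder (MinReps cs J) where
  le u v := BruhatLE cs u.1 v.1
  le_refl _ := Relation.ReflTransGen.refl
  le_trans _ _ _ h h' := Relation.ReflTransGen.trans h h'
  le_antisymm u v h h' := by
    apply Subtype.ext
    rcases h.eq_or_length_lt with h | h
    · exact h
    · rcases h'.eq_or_length_lt with h' | h'
      · exact h'.symm
      · exact absurd h (lt_asymm h')

end Bruhat

/-- The descending word `s_k s_{k-1} ⋯ s_1`, where `i : Fin n` stands for `k = i + 1`. -/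
def descWord {n : ℕ} (i : Fin n) : List (Fin n) :=
  ((List.finRange n).filter (· ≤ i)).reverse

/-- For `ks = [k_1, …, k_m]` the word `(s_{k_m} ⋯ s_1) ⋯ (s_{k_2} ⋯ s_1) (s_{k_1} ⋯ s_1)`. -/
def normalWord {n : ℕ} (ks : List (Fin n)) : List (Fin n) :=
  ks.reverse.flatMap descWord

/-- Rewrites a word in `s_1, …, s_n` as a word in `t_0, …, t_n`: each `s_i` with `i > 1` becomes
`t_i`, and the occurrences of `s_1`, counted from right to left, become `t_1, t_0, t_1, t_0, …`.
So an `s_1` becomes `t_0` exactly if the number of occurrences of `s_1` to its right is odd. -/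
def alternate {n : ℕ} : List (Fin n) → List (Fin (n + 1))
  | [] => []
  | i :: ω =>
    (if (i : ℕ) = 0 ∧ Odd (ω.countP fun j ↦ (j : ℕ) = 0) then 0 else i.succ) :: alternate ω

end BruhatQuotient

/-! ### The strong exchange property, by counting inversions modulo 2 -/

namespace CoxeterSystem

open List

variable {B : Type*} {M : CoxeterMatrix B} {W : Type*} [Group W] (cs : CoxeterSystem M W)

/-! Both quotients are realized on the subsets of {0, …, n-1}. A subset is encoded by its height
function (the number of elements that are at least `i`), and the order is the pointwise order of
heights. In type B the generator s_1 toggles the element 0, and s_{i+1} with i ≥ 1 exchanges i-1 and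
i. Type D acts in the same way, except that the toggle is shared by two generators: t_1 performs it
if the number of positive elements is even, t_0 if it is odd. In both cases the parabolic subgroup
fixes the empty set. A normal word builds its subset from the largest element down, inserting 0 and
raising it to the required place. The number of elements already present grows by one each time,
which is why t_1 and t_0 alternate.

`QuotientModel` isolates what is needed of such an action. A letter changes the rank (the sum of the
heights) by at most one, and a normal word is as long as the rank of its point; so normal words are
reduced and cannot end in a letter of J. Conversely, a generator times a normal form is a normal
form, or the same normal form times a generator of the parabolic (`absorbs_simple`, `absorbs_last`).
With the deletion property this shows that every minimal representative is a normal form.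

For the order, strong exchange turns a Bruhat step into the deletion of a letter from a reduced
word, and `act_le_act_of_sublist` shows that deleting letters lowers the point. In the other
direction, comparable heights are joined by an ascending chain of simple moves (`exists_flip_le`),
each of which is a Bruhat step. Thus `bruhatLE_iff` identifies both quotients with the same poset,
compatibly with the indices of the normal forms.

For arbitrary J and K of the given types, J is forced, and K is determined up to an automorphism of
the Coxeter graph (including the extra symmetry of D_4). -/

open Classical in
/-- The action of a simple reflection on pairs of a group element and a sign. -/
noncomputable def signedConj (i : B) : Function.End (W × ZMod 2) := fun p ↦
  (cs.simple i * p.1 * cs.simple i, p.2 + if p.1 = cs.simple i then 1 else 0)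

-- The sign changes whenever the element, conjugated by the suffix already applied, equals the next
-- generator. Conjugating back, this is an occurrence of the original element in the right inversion
-- sequence.
open Classical in
theorem prod_map_signedConj_apply (ω : List B) (p : W × ZMod 2) :
    (ω.map cs.signedConj).prod p =
      (cs.wordProd ω * p.1 * (cs.wordProd ω)⁻¹, p.2 + ((cs.rightInvSeq ω).count p.1 : ZMod 2)) := by
  induction ω with
  | nil => simp [Function.End.one_def]
  | cons i ω ih =>
    rw [map_cons, prod_cons]
    change cs.signedConj i ((ω.map cs.signedConj).prod p) = _
    rw [ih]
    simp only [signedConj, wordProd_cons, rightInvSeq, count_cons, mul_inv_rev, inv_simple,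
      Prod.mk.injEq]
    refine ⟨by group, ?_⟩
    have : cs.wordProd ω * p.1 * (cs.wordProd ω)⁻¹ = cs.simple i ↔
        (cs.wordProd ω)⁻¹ * cs.simple i * cs.wordProd ω = p.1 := by
      constructor
      · intro h; rw [← h]; group
      · intro h; rw [← h]; group
    simp only [this, beq_iff_eq]
    split_ifs <;> push_cast <;> ring

theorem prod_map_alternatingWord {G : Type*} [Monoid G] (f : B → G) (i j : B) (m : ℕ) :
    ((alternatingWord i j (2 * m)).map f).prod = (f i * f j) ^ m := by
  induction m with
  | zero => simp [alternatingWord]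
  | succ m ih =>
    rw [Nat.mul_succ, alternatingWord_succ', alternatingWord_succ']
    simp [parity_simps, ih, pow_succ', mul_assoc]

theorem reverse_alternatingWord_two_mul (i j : B) (m : ℕ) :
    (alternatingWord i j (2 * m)).reverse = alternatingWord j i (2 * m) := by
  induction m with
  | zero => simp [alternatingWord]
  | succ m ih =>
    rw [Nat.mul_succ, alternatingWord_succ', alternatingWord_succ']
    rw [alternatingWord_succ, alternatingWord_succ]
    simp [parity_simps, ih]

theorem leftInvSeq_alternatingWord_two_mul (i j : B) (m : ℕ) :
    cs.leftInvSeq (alternatingWord i j (2 * m)) =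
      (List.range (2 * m)).map fun k ↦ cs.simple i * (cs.simple j * cs.simple i) ^ k := by
  apply List.ext_getElem
  · simp
  · intro k h₁ h₂
    simp only [length_map, length_range] at h₂
    rw [getElem_leftInvSeq_alternatingWord _ _ _ _ _ h₂, prod_alternatingWord_eq_mul_pow]
    have : (2 * k + 1) / 2 = k := by omega
    simp [this, parity_simps]

-- The inversion sequence of a full braid relator runs twice through the same list, since the
-- product of the two generators has order dividing `M i j`. This makes the signs compatible with
-- the Coxeter relations.
open Classical in
theorem even_count_rightInvSeq_alternatingWord (i j : B) (t : W) :
    Even ((cs.rightInvSeq (alternatingWord i j (2 * M i j))).count t) := by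
  rw [← reverse_alternatingWord_two_mul, rightInvSeq_reverse, count_reverse,
    leftInvSeq_alternatingWord_two_mul, two_mul, range_add, map_append, count_append, map_map]
  have : ((fun k ↦ cs.simple j * (cs.simple i * cs.simple j) ^ k) ∘ fun x ↦ M i j + x) =
      fun k ↦ cs.simple j * (cs.simple i * cs.simple j) ^ k := by
    funext k
    simp [pow_add]
  rw [this]
  exact Even.add_self _

theorem isLiftable_signedConj : M.IsLiftable cs.signedConj := by
  intro i j
  rw [← prod_map_alternatingWord]
  funext p
  rw [prod_map_signedConj_apply]
  have h : cs.wordProd (alternatingWord i j (2 * M i j)) = 1 := by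
    rw [wordProd, prod_map_alternatingWord, simple_mul_simple_pow]
  have h' := (cs.even_count_rightInvSeq_alternatingWord i j p.1).natCast_zmod_two
  change (_, _) = p
  rw [h, h']
  simp

open Classical in
/-- The parity of the number of occurrences of `t` in the right inversion sequence of any word
for `w`. -/
noncomputable def inversionParity (w t : W) : ZMod 2 :=
  (cs.lift ⟨cs.signedConj, cs.isLiftable_signedConj⟩ w (t, 0)).2

theorem lift_signedConj_wordProd (ω : List B) :
    cs.lift ⟨cs.signedConj, cs.isLiftable_signedConj⟩ (cs.wordProd ω) =
      (ω.map cs.signedConj).prod := by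
  rw [wordProd, map_list_prod, map_map]
  congr 2
  funext i
  exact cs.lift_apply_simple _ i

open Classical in
theorem inversionParity_wordProd (ω : List B) (t : W) :
    cs.inversionParity (cs.wordProd ω) t = ((cs.rightInvSeq ω).count t : ZMod 2) := by
  rw [inversionParity, lift_signedConj_wordProd, prod_map_signedConj_apply]
  simp

theorem inversionParity_mul (u v t : W) :
    cs.inversionParity (u * v) t =
      cs.inversionParity u (v * t * v⁻¹) + cs.inversionParity v t := by
  obtain ⟨ω, rfl⟩ := cs.wordProd_surjective u
  obtain ⟨κ, rfl⟩ := cs.wordProd_surjective v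
  rw [inversionParity_wordProd, ← wordProd_append, inversionParity, lift_signedConj_wordProd,
    map_append, prod_append]
  change ((ω.map cs.signedConj).prod ((κ.map cs.signedConj).prod (t, 0))).2 = _
  rw [prod_map_signedConj_apply, prod_map_signedConj_apply, inversionParity_wordProd]
  simp [add_comm]

theorem inversionParity_one (t : W) : cs.inversionParity 1 t = 0 := by
  simpa using cs.inversionParity_wordProd [] t

/-- Writing t as u s u⁻¹, the contributions of u and u⁻¹ cancel by the cocycle identity for u u⁻¹ =
1; only that of s is left. -/
theorem inversionParity_self {t : W} (ht : cs.IsReflection t) : cs.inversionParity t t = 1 := by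
  obtain ⟨u, i, rfl⟩ := ht
  have h₁ : u⁻¹ * (u * cs.simple i * u⁻¹) * u⁻¹⁻¹ = cs.simple i := by group
  have h₂ : cs.simple i * cs.simple i * (cs.simple i)⁻¹ = cs.simple i := by group
  have h₃ : cs.inversionParity (cs.simple i) (cs.simple i) = 1 := by
    simpa using cs.inversionParity_wordProd [i] (cs.simple i)
  have h₄ := cs.inversionParity_mul u u⁻¹ (u * cs.simple i * u⁻¹)
  rw [mul_inv_cancel, inversionParity_one, h₁] at h₄
  rw [inversionParity_mul, inversionParity_mul, h₁, h₂, h₃]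
  linear_combination -h₄

theorem isRightInversion_of_inversionParity_eq_one {w t : W} (h : cs.inversionParity w t = 1) :
    cs.IsRightInversion w t := by
  classical
  obtain ⟨ω, hω, rfl⟩ := cs.exists_isReduced w
  apply cs.isRightInversion_of_mem_rightInvSeq hω
  rw [inversionParity_wordProd] at h
  by_contra hn
  rw [count_eq_zero_of_not_mem hn] at h
  simp at h

theorem inversionParity_eq_one_iff {w t : W} (ht : cs.IsReflection t) :
    cs.inversionParity w t = 1 ↔ cs.IsRightInversion w t := by
  refine ⟨cs.isRightInversion_of_inversionParity_eq_one, fun h ↦ ?_⟩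
  by_contra hn
  have h₀ : cs.inversionParity w t = 0 := by
    generalize cs.inversionParity w t = a at hn
    revert a
    decide
  -- An even parity for `w` is an odd one for `w * t`, so `t` is an inversion of `w * t` and hence
  -- not of `w`.
  refine ht.isRightInversion_mul_left_iff.mp
    (cs.isRightInversion_of_inversionParity_eq_one ?_) h
  rw [inversionParity_mul, cs.inversionParity_self ht, mul_assoc, mul_inv_cancel, mul_one, h₀,
    zero_add]

/-- The strong exchange property. -/
theorem exists_wordProd_eraseIdx_eq_mul {ω : List B} {t : W} (ht : cs.IsReflection t)
    (h : cs.length (cs.wordProd ω * t) < cs.length (cs.wordProd ω)) :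
    ∃ j < ω.length, cs.wordProd (ω.eraseIdx j) = cs.wordProd ω * t := by
  classical
  have h₁ := (cs.inversionParity_eq_one_iff ht).mpr ⟨ht, h⟩
  rw [inversionParity_wordProd] at h₁
  have hm : t ∈ cs.rightInvSeq ω := by
    by_contra hn
    rw [count_eq_zero_of_not_mem hn] at h₁
    simp at h₁
  obtain ⟨j, hj, rfl⟩ := List.mem_iff_getElem.mp hm
  refine ⟨j, by simpa using hj, ?_⟩
  rw [← List.getD_eq_getElem _ 1 hj, wordProd_mul_getD_rightInvSeq]

/-- A weak form of the deletion property. -/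
theorem exists_sublist_of_not_isReduced {ω : List B} (h : ¬ cs.IsReduced ω) :
    ∃ ω' : List B, ω'.Sublist ω ∧ ω'.length < ω.length ∧ cs.wordProd ω' = cs.wordProd ω := by
  induction ω with
  | nil => simp [IsReduced] at h
  | cons i ω ih =>
    by_cases hω : cs.IsReduced ω
    · have hlt : cs.length (cs.simple i * cs.wordProd ω) < cs.length (cs.wordProd ω) := by
        rcases cs.length_simple_mul (cs.wordProd ω) i with h' | h'
        · rw [IsReduced, wordProd_cons, h', hω.eq] at h
          simp at h
        · omega
      -- Left multiplication by the generator is right multiplication by this conjugate, to which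
      -- strong exchange applies.
      have ht : cs.IsReflection ((cs.wordProd ω)⁻¹ * cs.simple i * cs.wordProd ω) := by
        simpa using (cs.isReflection_simple i).conj (cs.wordProd ω)⁻¹
      obtain ⟨j, hj, he⟩ := cs.exists_wordProd_eraseIdx_eq_mul (ω := ω) ht (by
        simpa [← mul_assoc] using hlt)
      refine ⟨ω.eraseIdx j, (eraseIdx_sublist ω j).trans (sublist_cons_self i ω), ?_, ?_⟩
      · have := length_eraseIdx_le ω j
        simp only [length_cons]
        omega
      · rw [he, wordProd_cons]
        group
    · obtain ⟨ω', h₁, h₂, h₃⟩ := ih hω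
      exact ⟨i :: ω', h₁.cons_cons i, by simpa using h₂, by rw [wordProd_cons, wordProd_cons, h₃]⟩

end CoxeterSystem

/-! ### Parabolic quotients from an action on a graded poset -/

namespace BruhatQuotient

open CoxeterSystem

variable {B : Type*} {M : CoxeterMatrix B} {W : Type*} [Group W]

/-- A combinatorial model of the quotient `W^J`: an action of `W` on a graded poset `X` together
with a family of words, indexed by `I`, for the minimal representatives of the cosets of `W_J`. -/
structure QuotientModel (cs : CoxeterSystem M W) (J : Set B) (I X : Type*) [PartialOrder X] where
  /-- the action -/
  act : W →* Function.End X
  /-- the base point, which is fixed by `W_J` -/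
  base : X
  /-- the rank function of `X` -/
  rank : X → ℕ
  /-- the normal forms -/
  word : I → List B
  /-- the point which corresponds to a normal form -/
  point : I → X
  /-- the index of the empty word -/
  empty : I
  word_empty : word empty = []
  act_word : ∀ a, act (cs.wordProd (word a)) base = point a
  rank_mono : Monotone rank
  point_injective : Function.Injective point
  length_word : ∀ a, (word a).length = rank (point a)
  act_base : ∀ j ∈ J, act (cs.simple j) base = base
  act_cases : ∀ i x, act (cs.simple i) x = x ∨
    (x < act (cs.simple i) x ∧ rank (act (cs.simple i) x) = rank x + 1) ∨
    (act (cs.simple i) x < x ∧ rank x = rank (act (cs.simple i) x) + 1)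
  act_mono : ∀ i x y, x ≤ y → x < act (cs.simple i) x →
    act (cs.simple i) x ≤ y ∨ act (cs.simple i) x ≤ act (cs.simple i) y
  exists_act_le : ∀ x y, x < y → ∃ i, x < act (cs.simple i) x ∧ act (cs.simple i) x ≤ y
  simple_mul_word : ∀ i a,
    (∃ b, cs.simple i * cs.wordProd (word a) = cs.wordProd (word b)) ∨
      ∃ j ∈ J, cs.simple i * cs.wordProd (word a) = cs.wordProd (word a) * cs.simple j

namespace QuotientModel

variable {cs : CoxeterSystem M W} {J : Set B} {I X : Type*} [PartialOrder X]
  (m : QuotientModel cs J I X)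

include m

theorem act_one (x : X) : m.act 1 x = x := by
  rw [map_one]
  rfl

theorem act_mul (u v : W) (x : X) : m.act (u * v) x = m.act u (m.act v x) := by
  rw [map_mul]
  rfl

theorem rank_base : m.rank m.base = 0 := by
  have h := m.act_word m.empty
  have h' := m.length_word m.empty
  rw [m.word_empty] at h h'
  rw [← h, wordProd_nil, act_one] at h'
  simpa using h'.symm

theorem rank_act_simple_le (i : B) (x : X) : m.rank (m.act (cs.simple i) x) ≤ m.rank x + 1 := by
  rcases m.act_cases i x with h | h | h
  · rw [h]
    omega
  · omega
  · omega

theorem rank_act_wordProd_le (ω : List B) : m.rank (m.act (cs.wordProd ω) m.base) ≤ ω.length := by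
  induction ω with
  | nil => simp [m.act_one, m.rank_base]
  | cons i ω ih =>
    rw [wordProd_cons, act_mul]
    exact (m.rank_act_simple_le i _).trans (by simpa using ih)

theorem rank_act_le (w : W) : m.rank (m.act w m.base) ≤ cs.length w := by
  obtain ⟨ω, hω, rfl⟩ := cs.exists_isReduced w
  rw [hω.eq]
  exact m.rank_act_wordProd_le ω

/-- Every letter raises the rank by at most one, so no shorter word reaches the point of `a` from
the base. -/
theorem isReduced_word (a : I) : cs.IsReduced (m.word a) := by
  refine le_antisymm (cs.length_wordProd_le _) ?_
  rw [m.length_word, ← m.act_word]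
  exact m.rank_act_le _

theorem act_wordProd_base {κ : List B} (hκ : ∀ j ∈ κ, j ∈ J) :
    m.act (cs.wordProd κ) m.base = m.base := by
  induction κ with
  | nil => simp [m.act_one]
  | cons i κ ih =>
    rw [wordProd_cons, act_mul, ih (fun j hj ↦ hκ j (List.mem_cons_of_mem _ hj)),
      m.act_base i (hκ i List.mem_cons_self)]

/-- A last letter in `J` fixes the base point, so the word without it would reach the same point
with too few letters. -/
theorem isMinRep_word (a : I) : IsMinRep cs J (cs.wordProd (m.word a)) := by
  intro ω j hω h hj
  have h₁ : m.act (cs.wordProd ω) m.base = m.point a := by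
    rw [← m.act_word, ← h, wordProd_append, act_mul, wordProd_singleton, m.act_base j hj]
  have h₂ := m.rank_act_wordProd_le ω
  rw [h₁, ← m.length_word, ← (m.isReduced_word a).eq, ← h, hω.eq] at h₂
  simp at h₂

theorem exists_wordProd_mul (w : W) :
    ∃ a, ∃ κ : List B, (∀ j ∈ κ, j ∈ J) ∧ w = cs.wordProd (m.word a) * cs.wordProd κ := by
  induction w using cs.simple_induction_left with
  | one => exact ⟨m.empty, [], by simp, by simp [m.word_empty]⟩
  | mul_simple_left w i ih =>
    obtain ⟨a, κ, hκ, rfl⟩ := ih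
    rcases m.simple_mul_word i a with ⟨b, h⟩ | ⟨j, hj, h⟩
    · exact ⟨b, κ, hκ, by rw [← mul_assoc, h]⟩
    · exact ⟨a, j :: κ, by simpa [hj] using hκ, by rw [← mul_assoc, h, wordProd_cons, mul_assoc]⟩

/-- The factorization `W = W^J W_J` is additive on lengths. -/
theorem exists_isReduced_append (w : W) :
    ∃ a, ∃ κ : List B, (∀ j ∈ κ, j ∈ J) ∧ w = cs.wordProd (m.word a ++ κ) ∧
      cs.IsReduced (m.word a ++ κ) := by
  have hex : ∃ l a, ∃ κ : List B, κ.length = l ∧ (∀ j ∈ κ, j ∈ J) ∧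
      w = cs.wordProd (m.word a) * cs.wordProd κ := by
    obtain ⟨a, κ, h⟩ := m.exists_wordProd_mul w
    exact ⟨_, a, κ, rfl, h⟩
  classical
  -- Among all factorizations, the one with the shortest parabolic part is chosen.
  obtain ⟨a, κ, hl, hκ, hw⟩ := Nat.find_spec hex
  refine ⟨a, κ, hκ, by rw [wordProd_append, hw], ?_⟩
  by_contra hn
  obtain ⟨ω', hs, hlt, he⟩ := cs.exists_sublist_of_not_isReduced hn
  obtain ⟨ω₁, κ₁, rfl, h₁, h₂⟩ := List.sublist_append_iff.mp hs
  have hκ₁ : ∀ j ∈ κ₁, j ∈ J := fun j hj ↦ hκ j (h₂.subset hj)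
  rw [wordProd_append, wordProd_append] at he
  have hact : m.act (cs.wordProd ω₁) m.base = m.point a := by
    rw [← m.act_word]
    conv_lhs => rw [← m.act_wordProd_base hκ₁]
    conv_rhs => rw [← m.act_wordProd_base hκ]
    rw [← act_mul, ← act_mul, he]
  have hle := m.rank_act_wordProd_le ω₁
  rw [hact, ← m.length_word] at hle
  -- No letter can be deleted from `m.word a`, since what remains must still reach a point of rank
  -- `(m.word a).length`. So the deletion shortens `κ`, against minimality.
  have heq := h₁.eq_of_length_le hle
  subst heq
  rw [mul_right_inj] at he
  refine Nat.find_min hex (m := κ₁.length) ?_ ⟨a, κ₁, rfl, hκ₁, by rw [he, hw]⟩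
  rw [← hl]
  simpa using hlt

theorem exists_eq_wordProd {w : W} (hw : IsMinRep cs J w) : ∃ a, w = cs.wordProd (m.word a) := by
  obtain ⟨a, κ, hκ, h, hr⟩ := m.exists_isReduced_append w
  rcases List.eq_nil_or_concat κ with rfl | ⟨κ', j, rfl⟩
  · exact ⟨a, by simpa using h⟩
  · rw [List.concat_eq_append, ← List.append_assoc] at h hr
    exact absurd (hκ j (by simp)) (hw _ j hr h.symm)

/-- If the point went down, the normal form of `ω` would be replaced by a strictly shorter one with
the same parabolic part, and `i :: ω` would not be reduced. -/
theorem le_act_of_isReduced_cons {i : B} {ω : List B} (h : cs.IsReduced (i :: ω)) :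
    m.act (cs.wordProd ω) m.base ≤ m.act (cs.simple i) (m.act (cs.wordProd ω) m.base) := by
  have hω : cs.IsReduced ω := by simpa using h.drop 1
  obtain ⟨a, κ, hκ, hw, hr⟩ := m.exists_isReduced_append (cs.wordProd ω)
  have hx : m.act (cs.wordProd ω) m.base = m.point a := by
    rw [hw, wordProd_append, act_mul, m.act_wordProd_base hκ, m.act_word]
  rw [hx]
  rcases m.act_cases i (m.point a) with h' | h' | ⟨h₁, h₂⟩
  · exact h'.ge
  · exact h'.1.le
  exfalso
  rcases m.simple_mul_word i a with ⟨b, hb⟩ | ⟨j, hj, hb⟩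
  · have hpb : m.act (cs.simple i) (m.point a) = m.point b := by
      rw [← m.act_word, ← m.act_word, ← hb, act_mul]
    rw [hpb, ← m.length_word, ← m.length_word] at h₂
    have h₃ := h.eq
    rw [wordProd_cons, hw, wordProd_append, ← mul_assoc, hb, ← wordProd_append] at h₃
    have h₄ := cs.length_wordProd_le (m.word b ++ κ)
    have h₅ := hω.eq
    rw [hw, hr.eq] at h₅
    simp only [List.length_append, List.length_cons] at h₃ h₄ h₅
    omega
  · have : m.act (cs.simple i) (m.point a) = m.point a := by
      rw [← m.act_word, ← act_mul, hb, act_mul, m.act_base j hj]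
    exact h₁.ne this

/-- The easy half of a subword property. When both words keep their first letter, `act_mono` plays
the role of the lifting property of the Bruhat order. -/
theorem act_le_act_of_sublist {ω ω' : List B} (h : ω'.Sublist ω) (hr : cs.IsReduced ω) :
    m.act (cs.wordProd ω') m.base ≤ m.act (cs.wordProd ω) m.base := by
  induction h with
  | slnil => exact le_rfl
  | @cons ω' ω i h ih =>
    have hω : cs.IsReduced ω := by simpa using hr.drop 1
    rw [wordProd_cons, act_mul]
    exact (ih hω).trans (m.le_act_of_isReduced_cons hr)
  | @cons_cons ω' ω i h ih =>
    have hω : cs.IsReduced ω := by simpa using hr.drop 1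
    have hle := m.le_act_of_isReduced_cons hr
    rw [wordProd_cons, wordProd_cons, act_mul, act_mul]
    rcases m.act_cases i (m.act (cs.wordProd ω') m.base) with h' | h' | h'
    · rw [h']
      exact (ih hω).trans hle
    · rcases m.act_mono i _ _ (ih hω) h'.1 with h'' | h''
      · exact h''.trans hle
      · exact h''
    · exact h'.1.le.trans ((ih hω).trans hle)

theorem act_le_act_of_bruhatLE {u v : W} (h : BruhatLE cs u v) :
    m.act u m.base ≤ m.act v m.base := by
  induction h with
  | refl => exact le_rfl
  | @tail v w _ hs ih =>
    refine ih.trans ?_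
    obtain ⟨t, ht, rfl, hl⟩ := hs
    obtain ⟨ω, hω, he⟩ := cs.exists_isReduced (v * t)
    have hv : v = cs.wordProd ω * t := by rw [← he, mul_assoc, ht.mul_self, mul_one]
    rw [he, hv] at hl
    obtain ⟨j, -, hj⟩ := cs.exists_wordProd_eraseIdx_eq_mul ht hl
    rw [he, hv, ← hj]
    exact m.act_le_act_of_sublist (List.eraseIdx_sublist ω j) hω

/-- The point of `a` is raised by simple moves that stay below the point of `b`, by induction on the
difference of ranks. -/
theorem bruhatLE_of_le {a b : I} (h : m.point a ≤ m.point b) :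
    BruhatLE cs (cs.wordProd (m.word a)) (cs.wordProd (m.word b)) := by
  obtain ⟨d, hd⟩ : ∃ d, m.rank (m.point b) - m.rank (m.point a) = d := ⟨_, rfl⟩
  induction d generalizing a with
  | zero =>
    rcases h.eq_or_lt with h' | h'
    · rw [m.point_injective h']
      exact Relation.ReflTransGen.refl
    · obtain ⟨i, h₁, h₂⟩ := m.exists_act_le _ _ h'
      have h₃ := m.rank_mono h₂
      rcases m.act_cases i (m.point a) with h₄ | h₄ | h₄
      · exact absurd h₄ h₁.ne'
      · omega
      · exact absurd h₄.1 h₁.asymm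
  | succ d ih =>
    have hne : m.point a ≠ m.point b := by
      intro h'
      rw [h'] at hd
      omega
    obtain ⟨i, h₁, h₂⟩ := m.exists_act_le _ _ (h.lt_of_ne hne)
    have h₃ := m.rank_mono h₂
    rcases m.act_cases i (m.point a) with h₄ | h₄ | h₄
    · exact absurd h₄ h₁.ne'
    · rcases m.simple_mul_word i a with ⟨c, hc⟩ | ⟨j, hj, hc⟩
      · have hpc : m.act (cs.simple i) (m.point a) = m.point c := by
          rw [← m.act_word, ← m.act_word, ← hc, act_mul]
        rw [hpc] at h₂ h₃ h₄
        refine Relation.ReflTransGen.head ?_ (ih h₂ (by omega))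
        -- The conjugate reflection turns the simple move on the left into a Bruhat step on the
        -- right.
        refine ⟨(cs.wordProd (m.word a))⁻¹ * cs.simple i * cs.wordProd (m.word a), ?_, ?_, ?_⟩
        · simpa using (cs.isReflection_simple i).conj (cs.wordProd (m.word a))⁻¹
        · rw [← hc]
          group
        · rw [(m.isReduced_word a).eq, (m.isReduced_word c).eq, m.length_word, m.length_word]
          omega
      · have : m.act (cs.simple i) (m.point a) = m.point a := by
          rw [← m.act_word, ← act_mul, hc, act_mul, m.act_base j hj]
        exact absurd this h₁.ne'
    · exact absurd h₄.1 h₁.asymm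

theorem bruhatLE_iff {a b : I} :
    BruhatLE cs (cs.wordProd (m.word a)) (cs.wordProd (m.word b)) ↔ m.point a ≤ m.point b := by
  refine ⟨fun h ↦ ?_, m.bruhatLE_of_le⟩
  rw [← m.act_word, ← m.act_word]
  exact m.act_le_act_of_bruhatLE h

theorem wordProd_word_injective : Function.Injective fun a ↦ cs.wordProd (m.word a) := by
  intro a b h
  apply m.point_injective
  rw [← m.act_word, ← m.act_word]
  exact congrArg (fun w ↦ m.act w m.base) h

/-- The bijection between the indices of the normal forms and `W^J`. -/
noncomputable def equivMinReps : I ≃ MinReps cs J :=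
  Equiv.ofBijective (fun a ↦ ⟨cs.wordProd (m.word a), m.isMinRep_word a⟩) <| by
    refine ⟨fun a b h ↦ m.wordProd_word_injective (congrArg Subtype.val h), fun w ↦ ?_⟩
    obtain ⟨a, ha⟩ := m.exists_eq_wordProd w.2
    exact ⟨a, Subtype.ext ha.symm⟩

theorem equivMinReps_le_iff {a b : I} :
    m.equivMinReps a ≤ m.equivMinReps b ↔ m.point a ≤ m.point b :=
  m.bruhatLE_iff

omit m in
/-- Two models with the same points give isomorphic quotients. -/
noncomputable def orderIso {B' : Type*} {M' : CoxeterMatrix B'} {U : Type*} [Group U]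
    {cs' : CoxeterSystem M' U} {K : Set B'} (m : QuotientModel cs J I X)
    (m' : QuotientModel cs' K I X) (h : m.point = m'.point) : MinReps cs J ≃o MinReps cs' K where
  toEquiv := m.equivMinReps.symm.trans m'.equivMinReps
  map_rel_iff' {u v} := by
    obtain ⟨a, rfl⟩ := m.equivMinReps.surjective u
    obtain ⟨b, rfl⟩ := m.equivMinReps.surjective v
    simp only [Equiv.trans_apply, Equiv.symm_apply_apply]
    rw [equivMinReps_le_iff, equivMinReps_le_iff, h]

omit m in
theorem orderIso_equivMinReps {B' : Type*} {M' : CoxeterMatrix B'} {U : Type*} [Group U]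
    {cs' : CoxeterSystem M' U} {K : Set B'} (m : QuotientModel cs J I X)
    (m' : QuotientModel cs' K I X) (h : m.point = m'.point) (a : I) :
    m.orderIso m' h (m.equivMinReps a) = m'.equivMinReps a := by
  change m'.equivMinReps (m.equivMinReps.symm (m.equivMinReps a)) = _
  rw [Equiv.symm_apply_apply]

end QuotientModel

end BruhatQuotient

/-! ### Height functions and the operations on them -/

namespace BruhatQuotient

/-- A height function of size `n` encodes a subset of `{0, …, n - 1}` by the numbers of its
elements that are at least `i`. -/
@[ext]
structure HeightFun (n : ℕ) where
  /-- the number of elements that are at least `i` -/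
  val : ℕ → ℤ
  succ_le : ∀ i, val (i + 1) ≤ val i
  le_succ : ∀ i, val i ≤ val (i + 1) + 1
  eq_zero : ∀ i, n ≤ i → val i = 0

namespace HeightFun

variable {n : ℕ}

theorem val_injective : Function.Injective (val : HeightFun n → ℕ → ℤ) :=
  fun _ _ ↦ HeightFun.ext

noncomputable instance : PartialOrder (HeightFun n) := PartialOrder.lift val val_injective

theorem le_def {x y : HeightFun n} : x ≤ y ↔ ∀ i, x.val i ≤ y.val i :=
  Iff.rfl

theorem nonneg (x : HeightFun n) (i : ℕ) : 0 ≤ x.val i :=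
  Nat.decreasingInduction (motive := fun i _ ↦ 0 ≤ x.val i)
    (fun k _ h ↦ h.trans (x.succ_le k)) (x.eq_zero _ (le_max_left n i)).ge (le_max_right n i)

/-- The height function of the empty set. -/
def zero (n : ℕ) : HeightFun n where
  val _ := 0
  succ_le := by simp
  le_succ := by simp
  eq_zero := by simp

@[simp]
theorem zero_val (i : ℕ) : (zero n).val i = 0 :=
  rfl

/-- The only value at `i` that could replace `x i`. -/
def flipValue (x : ℕ → ℤ) : ℕ → ℤ
  -- The difference `x 0 - x 1`, which is 1 if 0 belongs to the subset and 0 otherwise, becomes its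
  -- complement.
  | 0 => 2 * x 1 + 1 - x 0
  -- The two successive differences around `i + 1` are exchanged, so `i` and `i + 1` swap their
  -- membership.
  | i + 1 => x i + x (i + 1 + 1) - x (i + 1)

/-- The action of the generator `s_{i + 1}` of the group of type `B_n`. -/
def flip (i : Fin n) (x : HeightFun n) : HeightFun n where
  val k := if k = i then flipValue x.val i else x.val k
  succ_le k := by
    have h₁ := x.succ_le k
    have h₂ := x.le_succ k
    obtain ⟨i | i, hi⟩ := i
    · rcases k with _ | k <;> simp [flipValue] at * <;> omega
    · have h₃ := x.succ_le (k + 1)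
      have h₄ := x.le_succ i
      have h₅ := x.succ_le (i + 1)
      have h₇ := x.succ_le i
      have h₆ := x.le_succ (i + 1)
      simp only [flipValue]
      split_ifs <;> subst_vars <;> simp_all only [Nat.add_right_cancel_iff] <;> omega
  le_succ k := by
    have h₁ := x.succ_le k
    have h₂ := x.le_succ k
    obtain ⟨i | i, hi⟩ := i
    · rcases k with _ | k <;> simp [flipValue] at * <;> omega
    · have h₃ := x.succ_le (k + 1)
      have h₄ := x.le_succ i
      have h₅ := x.succ_le (i + 1)
      have h₇ := x.succ_le i
      have h₆ := x.le_succ (i + 1)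
      simp only [flipValue]
      split_ifs <;> subst_vars <;> simp_all only [Nat.add_right_cancel_iff] <;> omega
  eq_zero k hk := by
    rw [if_neg (by have := i.2; omega), x.eq_zero k hk]

theorem flip_val (i : Fin n) (x : HeightFun n) (k : ℕ) :
    (flip i x).val k = if k = i then flipValue x.val i else x.val k :=
  rfl

theorem flip_val_self (i : Fin n) (x : HeightFun n) : (flip i x).val i = flipValue x.val i :=
  if_pos rfl

theorem flip_val_of_ne {i : Fin n} (x : HeightFun n) {k : ℕ} (h : k ≠ i) :
    (flip i x).val k = x.val k :=
  if_neg h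

theorem flipValue_congr {x y : ℕ → ℤ} {i : ℕ} (h₀ : ∀ k, k + 1 = i → x k = y k) (h₁ : x i = y i)
    (h₂ : x (i + 1) = y (i + 1)) : flipValue x i = flipValue y i := by
  rcases i with _ | i
  · simp only [zero_add] at h₂
    simp only [flipValue, h₁, h₂]
  · simp only [flipValue, h₁, h₂, h₀ i rfl]

theorem flip_flip (i : Fin n) (x : HeightFun n) : flip i (flip i x) = x := by
  ext k
  by_cases h : k = i
  · subst h
    obtain ⟨i | i, hi⟩ := i <;> simp [flip_val, flipValue]
  · rw [flip_val_of_ne _ h, flip_val_of_ne _ h]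

theorem flip_comm {i j : Fin n} (h : (i : ℕ) + 1 < j) (x : HeightFun n) :
    flip i (flip j x) = flip j (flip i x) := by
  ext k
  by_cases hi : k = i
  · subst hi
    rw [flip_val_self, flip_val_of_ne _ (by omega), flip_val_self]
    apply flipValue_congr
    · exact fun k hk ↦ flip_val_of_ne _ (by omega)
    · exact flip_val_of_ne _ (by omega)
    · exact flip_val_of_ne _ (by omega)
  by_cases hj : k = j
  · subst hj
    rw [flip_val_of_ne _ hi, flip_val_self, flip_val_self]
    symm
    apply flipValue_congr
    · exact fun k hk ↦ flip_val_of_ne _ (by omega)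
    · exact flip_val_of_ne _ (by omega)
    · exact flip_val_of_ne _ (by omega)
  simp only [flip_val, hi, hj, if_false]

theorem flip_braid {i j : Fin n} (h₀ : (i : ℕ) ≠ 0) (h : (i : ℕ) + 1 = j) (x : HeightFun n) :
    flip i (flip j (flip i x)) = flip j (flip i (flip j x)) := by
  ext k
  obtain ⟨i, hi⟩ := i
  obtain ⟨j, hj⟩ := j
  simp only at h₀ h
  subst h
  obtain ⟨i, rfl⟩ := Nat.exists_eq_succ_of_ne_zero h₀
  have h' : i ≠ i + 2 := by omega
  have h'' : i + 1 + 1 ≠ i := by omega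
  by_cases h₁ : k = i + 1
  · subst h₁
    simp [flip_val, flipValue, h', h'']
    try ring
  by_cases h₂ : k = i + 2
  · subst h₂
    simp [flip_val, flipValue, h', h'']
    try ring
  simp [flip_val, h₁, h₂]

theorem flip_braid_zero {i j : Fin n} (h₀ : (i : ℕ) = 0) (h : (j : ℕ) = 1) (x : HeightFun n) :
    flip i (flip j (flip i (flip j x))) = flip j (flip i (flip j (flip i x))) := by
  ext k
  obtain ⟨i, hi⟩ := i
  obtain ⟨j, hj⟩ := j
  simp only at h₀ h
  subst h h₀
  by_cases h₁ : k = 0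
  · subst h₁
    simp [flip_val, flipValue]
    try ring
  by_cases h₂ : k = 1
  · subst h₂
    simp [flip_val, flipValue]
    try ring
  simp [flip_val, h₁, h₂]

/-- The action of the generators `t_1` (for `p = 0`) and `t_0` (for `p = 1`) of the group of type
`D_{n + 1}`. -/
def flipMod (p : ℤ) (i : Fin n) (x : HeightFun n) : HeightFun n :=
  if x.val (i + 1) % 2 = p then flip i x else x

/-- The parity test reads the height at `i + 1`, which a flip at `i` leaves alone. -/
theorem flipMod_flipMod (p : ℤ) (i : Fin n) (x : HeightFun n) :
    flipMod p i (flipMod p i x) = x := by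
  have : (flip i x).val (i + 1) = x.val (i + 1) := by simp [flip_val]
  unfold flipMod
  split_ifs <;> simp_all [flip_flip]

theorem flipMod_comm (p q : ℤ) (i : Fin n) (x : HeightFun n) :
    flipMod p i (flipMod q i x) = flipMod q i (flipMod p i x) := by
  have : (flip i x).val (i + 1) = x.val (i + 1) := by simp [flip_val]
  unfold flipMod
  split_ifs <;> simp_all [flip_flip]

theorem flipMod_flip_comm (p : ℤ) {i j : Fin n} (h : (i : ℕ) + 1 < j) (x : HeightFun n) :
    flipMod p i (flip j x) = flip j (flipMod p i x) := by
  have : (flip j x).val (i + 1) = x.val (i + 1) := by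
    rw [flip_val, if_neg h.ne]
  unfold flipMod
  rw [this]
  split_ifs
  · exact flip_comm h x
  · rfl

/-- With the height at 2 fixed, there are four possibilities for the membership of 0 and 1. The
parity test allows the toggle for just one of the two states of 1. So the maps fix one of the four
possibilities and act on the other three as two adjacent transpositions; hence order 3, where the
unrestricted toggle has order 4. -/
theorem flipMod_braid {p : ℤ} (hp : p = 0 ∨ p = 1) {i j : Fin n} (h₀ : (i : ℕ) = 0)
    (h : (j : ℕ) = 1) (x : HeightFun n) :
    flipMod p i (flip j (flipMod p i x)) = flip j (flipMod p i (flip j x)) := by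
  obtain ⟨i, hi⟩ := i
  obtain ⟨j, hj⟩ := j
  simp only at h₀ h
  subst h h₀
  have e₁ := x.succ_le 0
  have e₂ := x.le_succ 0
  have e₃ := x.succ_le 1
  have e₄ := x.le_succ 1
  ext k
  have hval (x : HeightFun n) (k : ℕ) : (flipMod p ⟨0, hi⟩ x).val k =
      if k = 0 ∧ x.val 1 % 2 = p then 2 * x.val 1 + 1 - x.val 0 else x.val k := by
    unfold flipMod
    by_cases h : x.val 1 % 2 = p <;> simp [h, flip_val, flipValue]
  by_cases h₁ : k = 0
  · subst h₁
    simp only [hval, flip_val, flipValue, reduceIte, true_and, zero_ne_one, one_ne_zero,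
      false_and, zero_add, Nat.reduceAdd, OfNat.ofNat_ne_one, OfNat.ofNat_ne_zero] at *
    split_ifs <;> omega
  by_cases h₂ : k = 1
  · subst h₂
    simp only [hval, flip_val, flipValue, reduceIte, true_and, zero_ne_one, one_ne_zero,
      false_and, zero_add, Nat.reduceAdd, OfNat.ofNat_ne_one, OfNat.ofNat_ne_zero] at *
    split_ifs <;> omega
  simp [hval, flip_val, h₁, h₂]

end HeightFun

end BruhatQuotient

/-! ### Multiplying normal forms by generators -/

namespace BruhatQuotient

section NormalForm

variable {G : Type*} [Group G]

/-- The product `s k * ⋯ * s 1 * x`. -/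
def descProd (s : ℕ → G) (x : G) : ℕ → G
  | 0 => x
  | k + 1 => s (k + 1) * descProd s x k

/-- The product of the descending products of the elements of a list, from the last to the first,
which end alternately in `e ε` and `e (!ε)`. -/
def normalProd (s : ℕ → G) (e : Bool → G) : Bool → List ℕ → G
  | _, [] => 1
  | ε, k :: ks => normalProd s e (!ε) ks * descProd s (e ε) k

/-- The relations that normal forms in the groups of type `B_n` and `D_{n + 1}` depend on. In type
`B_n` both `e true` and `e false` are `s_1`; in type `D_{n + 1}` they are `t_1` and `t_0`. The
generators of the parabolic subgroup are `s 1, …, s (n - 1)` and the elements of `Z true`. -/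
structure NormalFormRelations (n : ℕ) (s : ℕ → G) (e : Bool → G) (Z : Bool → Set G) : Prop where
  sq : ∀ i, 1 ≤ i → i < n → s i * s i = 1
  comm : ∀ i j, 1 ≤ i → i + 1 < j → j < n → s i * s j = s j * s i
  braid : ∀ i, 1 ≤ i → i + 1 < n → s i * s (i + 1) * s i = s (i + 1) * s i * s (i + 1)
  sq_last : ∀ ε, e ε * e ε = 1
  comm_last : ∀ ε i, 2 ≤ i → i < n → s i * e ε = e ε * s i
  exists_braid : ∀ ε, 1 < n →
    ∃ z, (z ∈ Z ε ∨ z = s 1) ∧ s 1 * e (!ε) * s 1 * e ε = e (!ε) * s 1 * e ε * z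
  comm_extra : ∀ ε, ∀ z ∈ Z ε, ∀ i, 2 ≤ i → i < n → s i * z = z * s i
  braid_extra : ∀ ε, ∀ z ∈ Z ε, 1 < n → z * s 1 * e (!ε) = s 1 * e (!ε) * s 1
  last_not : ∀ ε, e (!ε) = e ε ∨ e (!ε) ∈ Z ε ∧ e (!ε) * e ε = e ε * e (!ε)

/-- Multiplication by `g` on the left maps the normal form given by `ks` to another one that
involves only indices below `m`, or amounts to multiplication by a generator of the parabolic
subgroup on the right. -/
def Absorbs (s : ℕ → G) (e : Bool → G) (Z : Bool → Set G) (m : ℕ) (ε : Bool)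
    (g : G) (ks : List ℕ) : Prop :=
  (∃ ks' : List ℕ, ks'.Pairwise (· > ·) ∧ (∀ k ∈ ks', k < m) ∧
    g * normalProd s e ε ks = normalProd s e ε ks') ∨
  ∃ z, (z ∈ Z ε ∨ ∃ j, 1 ≤ j ∧ j < m ∧ z = s j) ∧
    g * normalProd s e ε ks = normalProd s e ε ks * z

namespace NormalFormRelations

variable {n : ℕ} {s : ℕ → G} {e : Bool → G} {Z : Bool → Set G} (h : NormalFormRelations n s e Z)

include h

theorem mul_descProd_comm (ε : Bool) {i k : ℕ} (hk : k + 1 < i) (hi : i < n) :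
    s i * descProd s (e ε) k = descProd s (e ε) k * s i := by
  induction k with
  | zero => exact h.comm_last ε i hk hi
  | succ k ih =>
    rw [descProd, mul_assoc, ← ih (by omega), ← mul_assoc, ← mul_assoc,
      h.comm (k + 1) i (by omega) (by omega) hi]

/-- One braid relation at the place where `s (i + 1) * s i` occurs in the product; all other factors
commute past. -/
theorem mul_descProd_shift (ε : Bool) {i k : ℕ} (hi : 1 ≤ i) (hk : i + 1 ≤ k) (hn : k < n) :
    s i * descProd s (e ε) k = descProd s (e ε) k * s (i + 1) := by
  induction k, hk using Nat.le_induction with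
  | base =>
    obtain ⟨i, rfl⟩ := Nat.exists_eq_add_of_le' hi
    rw [descProd, descProd, ← mul_assoc, ← mul_assoc, h.braid _ hi hn, mul_assoc,
      h.mul_descProd_comm ε (by omega) hn]
    simp only [mul_assoc]
  | succ k hk ih =>
    rw [descProd, mul_assoc, ← ih (by omega), ← mul_assoc, ← mul_assoc,
      h.comm i (k + 1) hi (by omega) hn]

theorem mul_descProd_extra (ε : Bool) {z : G} (hz : z ∈ Z (!ε)) {k : ℕ} (hk : 1 ≤ k)
    (hn : k < n) : z * descProd s (e ε) k = descProd s (e ε) k * s 1 := by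
  induction k, hk using Nat.le_induction with
  | base =>
    have := h.braid_extra (!ε) z hz hn
    rw [Bool.not_not] at this
    rw [descProd, descProd, ← mul_assoc, this]
  | succ k hk ih =>
    rw [descProd, mul_assoc, ← ih (by omega), ← mul_assoc, ← mul_assoc,
      h.comm_extra _ z hz (k + 1) (by omega) hn]

/-- For neighbouring indices a generator passes through both products. A braid relation lowers `k`
until only `exists_braid` remains, the one place where types B and D differ in the outcome. -/
theorem exists_mul_descProd_descProd (ε : Bool) {k : ℕ} (hn : k + 1 < n) :
    ∃ z, (z ∈ Z ε ∨ z = s 1) ∧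
      s (k + 1) * (descProd s (e (!ε)) k * descProd s (e ε) (k + 1)) =
        descProd s (e (!ε)) k * descProd s (e ε) (k + 1) * z := by
  induction k with
  | zero =>
    obtain ⟨z, hz, h'⟩ := h.exists_braid ε hn
    refine ⟨z, hz, ?_⟩
    simpa only [descProd, mul_assoc, zero_add] using h'
  | succ k ih =>
    obtain ⟨z, hz, h'⟩ := ih (by omega)
    refine ⟨z, hz, ?_⟩
    have h₁ := h.mul_descProd_comm (!ε) (i := k + 1 + 1) (k := k) (by omega) hn
    have h₂ := h.braid (k + 1) (by omega) hn
    calc s (k + 1 + 1) * (descProd s (e (!ε)) (k + 1) * descProd s (e ε) (k + 1 + 1))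
      _ = s (k + 1 + 1) * s (k + 1) * (descProd s (e (!ε)) k * s (k + 1 + 1)) *
            descProd s (e ε) (k + 1) := by simp only [descProd, mul_assoc]
      _ = s (k + 1 + 1) * s (k + 1) * s (k + 1 + 1) * descProd s (e (!ε)) k *
            descProd s (e ε) (k + 1) := by rw [← h₁]; simp only [mul_assoc]
      _ = s (k + 1) * s (k + 1 + 1) * (s (k + 1) * (descProd s (e (!ε)) k *
            descProd s (e ε) (k + 1))) := by rw [← h₂]; simp only [mul_assoc]
      _ = s (k + 1) * (s (k + 1 + 1) * descProd s (e (!ε)) k) * descProd s (e ε) (k + 1) * z := by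
        rw [h']; simp only [mul_assoc]
      _ = _ := by rw [h₁]; simp only [descProd, mul_assoc]

theorem mul_normalProd_comm (ε : Bool) {i : ℕ} {ks : List ℕ} (hks : ∀ k ∈ ks, k + 1 < i)
    (hi : i < n) : s i * normalProd s e ε ks = normalProd s e ε ks * s i := by
  induction ks generalizing ε with
  | nil => simp [normalProd]
  | cons k ks ih =>
    rw [normalProd, mul_assoc, ← h.mul_descProd_comm ε (hks k List.mem_cons_self) hi, ← mul_assoc,
      ← mul_assoc, ih _ fun k hk ↦ hks k (List.mem_cons_of_mem _ hk)]

/-- A parabolic generator that comes out of the tail passes through the product of the head: extra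
generators become `s 1`, and `s j` becomes `s (j + 1)`. As `j < k < m`, the bound is kept. -/
theorem absorbs_cons {ε : Bool} {g : G} {k m : ℕ} {ks : List ℕ} (hk : 1 ≤ k) (hkm : k < m)
    (hm : m ≤ n) (hg : Absorbs s e Z k (!ε) g ks) : Absorbs s e Z m ε g (k :: ks) := by
  rcases hg with ⟨ks', h₁, h₂, h₃⟩ | ⟨z, hz | ⟨j, hj, hj', rfl⟩, h₃⟩
  · refine Or.inl ⟨k :: ks', List.pairwise_cons.mpr ⟨h₂, h₁⟩, ?_, ?_⟩
    · intro l hl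
      rcases List.mem_cons.mp hl with rfl | hl
      · exact hkm
      · exact (h₂ l hl).trans hkm
    · rw [normalProd, normalProd, ← h₃, mul_assoc]
  · refine Or.inr ⟨s 1, Or.inr ⟨1, le_rfl, by omega, rfl⟩, ?_⟩
    rw [normalProd, ← mul_assoc, h₃, mul_assoc, h.mul_descProd_extra ε hz hk (by omega), mul_assoc]
  · refine Or.inr ⟨s (j + 1), Or.inr ⟨j + 1, by omega, by omega, rfl⟩, ?_⟩
    rw [normalProd, ← mul_assoc, h₃, mul_assoc, h.mul_descProd_shift ε hj hj' (by omega),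
      mul_assoc]

theorem absorbs_simple {ε : Bool} {i m : ℕ} {ks : List ℕ} (hi : 1 ≤ i) (him : i < m) (hm : m ≤ n)
    (hks : ks.Pairwise (· > ·)) (hlt : ∀ k ∈ ks, k < m) : Absorbs s e Z m ε (s i) ks := by
  induction ks generalizing ε m with
  | nil => exact Or.inr ⟨s i, Or.inr ⟨i, hi, him, rfl⟩, by simp [normalProd]⟩
  | cons k ks ih =>
    obtain ⟨h₁, h₂⟩ := List.pairwise_cons.mp hks
    have hk := hlt k List.mem_cons_self
    have hlt' : ∀ l ∈ ks, l < m := fun l hl ↦ hlt l (List.mem_cons_of_mem _ hl)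
    rcases lt_trichotomy i k with hik | rfl | hik
    · exact h.absorbs_cons (by omega) hk hm (ih hik (by omega) h₂ h₁)
    · obtain ⟨k, rfl⟩ := Nat.exists_eq_add_of_le' hi
      -- If the next lower index is free, the generator cancels and lowers the head by one.
      -- Otherwise the two neighbouring products let the generator through.
      by_cases hc : ∀ l ∈ ks, l < k
      · refine Or.inl ⟨k :: ks, List.pairwise_cons.mpr ⟨hc, h₂⟩, ?_, ?_⟩
        · intro l hl
          rcases List.mem_cons.mp hl with rfl | hl
          · omega
          · exact hlt' l hl
        · rw [normalProd, ← mul_assoc, h.mul_normalProd_comm _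
            (fun l hl ↦ by have := hc l hl; omega) (by omega), mul_assoc, descProd,
            ← mul_assoc (s (k + 1)), h.sq _ hi (by omega), one_mul, normalProd]
      · rcases ks with _ | ⟨l, ks⟩
        · simp at hc
        · obtain ⟨h₃, h₄⟩ := List.pairwise_cons.mp h₂
          have hl := h₁ l List.mem_cons_self
          obtain rfl : l = k := by
            by_contra hne
            refine hc fun j hj ↦ ?_
            rcases List.mem_cons.mp hj with rfl | hj
            · omega
            · have := h₃ j hj
              omega
          obtain ⟨z, hz, h₅⟩ := h.exists_mul_descProd_descProd ε (k := l) (by omega)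
          refine Or.inr ⟨z, hz.imp_right fun hz ↦ ⟨1, le_rfl, by omega, hz⟩, ?_⟩
          rw [normalProd, normalProd, mul_assoc, ← mul_assoc (s (l + 1)), h.mul_normalProd_comm _
            (fun j hj ↦ by have := h₃ j hj; omega) (by omega), mul_assoc, h₅]
          simp only [mul_assoc]
    · rcases (show k + 1 ≤ i from hik).eq_or_lt with rfl | hik
      -- The generator lengthens the product of the head.
      · refine Or.inl ⟨(k + 1) :: ks, List.pairwise_cons.mpr ⟨?_, h₂⟩, ?_, ?_⟩
        · intro l hl
          have := h₁ l hl
          omega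
        · intro l hl
          rcases List.mem_cons.mp hl with rfl | hl
          · omega
          · exact hlt' l hl
        · rw [normalProd, ← mul_assoc, h.mul_normalProd_comm _
            (fun l hl ↦ by have := h₁ l hl; omega) (by omega), mul_assoc, normalProd, descProd]
      · refine Or.inr ⟨s i, Or.inr ⟨i, hi, him, rfl⟩, h.mul_normalProd_comm _ ?_ (by omega)⟩
        intro l hl
        rcases List.mem_cons.mp hl with rfl | hl
        · omega
        · have := h₁ l hl
          omega

/-- Only an entry 0 matters once the larger ones are peeled off: the generator with the right sign
inserts or removes it, and the other one commutes with what is left and is parabolic at that stage.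
-/
theorem absorbs_last {ε ε' : Bool} {m : ℕ} {ks : List ℕ} (hm₀ : 1 ≤ m) (hm : m ≤ n)
    (hks : ks.Pairwise (· > ·)) (hlt : ∀ k ∈ ks, k < m) : Absorbs s e Z m ε (e ε') ks := by
  induction ks generalizing ε m with
  | nil =>
    by_cases hε : e ε' = e ε
    · exact Or.inl ⟨[0], by simp, by simpa using Nat.pos_of_ne_zero (by omega), by simp [normalProd, descProd, hε]⟩
    · obtain rfl : ε' = !ε := by
        rcases ε with _ | _ <;> rcases ε' with _ | _ <;> simp_all
      rcases h.last_not ε with h' | h'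
      · exact absurd h' hε
      · exact Or.inr ⟨_, Or.inl h'.1, by simp [normalProd]⟩
  | cons k ks ih =>
    obtain ⟨h₁, h₂⟩ := List.pairwise_cons.mp hks
    have hk := hlt k List.mem_cons_self
    rcases Nat.eq_zero_or_pos k with rfl | hk₀
    · obtain rfl : ks = [] := by
        rw [List.eq_nil_iff_forall_not_mem]
        intro l hl
        exact absurd (h₁ l hl) (by simp)
      by_cases hε : e ε' = e ε
      · exact Or.inl ⟨[], by simp, by simp, by simp [normalProd, descProd, hε, h.sq_last]⟩
      · obtain rfl : ε' = !ε := by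
          rcases ε with _ | _ <;> rcases ε' with _ | _ <;> simp_all
        rcases h.last_not ε with h' | h'
        · exact absurd h' hε
        · exact Or.inr ⟨_, Or.inl h'.1, by simp [normalProd, descProd, h'.2]⟩
    · exact h.absorbs_cons hk₀ hk hm (ih hk₀ (by omega) h₂ h₁)

end NormalFormRelations

end NormalForm

end BruhatQuotient

/-! ### Order and rank of height functions, and decreasing lists -/

namespace BruhatQuotient

namespace HeightFun

variable {n : ℕ}

theorem val_le_val {x y : HeightFun n} (h : x ≤ y) (i : ℕ) : x.val i ≤ y.val i :=
  h i

/-- The sum of the heights. -/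
noncomputable def rank (x : HeightFun n) : ℕ :=
  (∑ i ∈ Finset.range n, x.val i).toNat

theorem natCast_rank (x : HeightFun n) : (x.rank : ℤ) = ∑ i ∈ Finset.range n, x.val i :=
  Int.toNat_of_nonneg (Finset.sum_nonneg fun i _ ↦ x.nonneg i)

theorem rank_mono : Monotone (rank : HeightFun n → ℕ) :=
  fun _ _ h ↦ Int.toNat_le_toNat (Finset.sum_le_sum fun i _ ↦ h i)

theorem rank_flip (i : Fin n) (x : HeightFun n) :
    ((flip i x).rank : ℤ) = x.rank + (flipValue x.val i - x.val i) := by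
  rw [natCast_rank, natCast_rank, ← sub_eq_iff_eq_add', ← Finset.sum_sub_distrib]
  have (k : ℕ) : (flip i x).val k - x.val k =
      if k = i then flipValue x.val i - x.val i else 0 := by
    rw [flip_val]
    split_ifs with h
    · rw [h]
    · simp
  simp [this]

theorem le_flip {i : Fin n} {x : HeightFun n} (h : x.val i ≤ flipValue x.val i) :
    x ≤ flip i x := by
  intro k
  rw [flip_val]
  split_ifs with hk
  · rwa [hk]
  · exact le_rfl

theorem flip_le {i : Fin n} {x y : HeightFun n} (hxy : x ≤ y)
    (h : flipValue x.val i ≤ y.val i) : flip i x ≤ y := by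
  intro k
  rw [flip_val]
  split_ifs with hk
  · rwa [hk]
  · exact hxy k

theorem flip_ne {i : Fin n} {x : HeightFun n} (h : x.val i ≠ flipValue x.val i) :
    flip i x ≠ x := by
  intro h'
  rw [← flip_val_self, h'] at h
  exact h rfl

theorem flip_eq {i : Fin n} {x : HeightFun n} (h : x.val i = flipValue x.val i) :
    flip i x = x := by
  ext k
  rw [flip_val]
  split_ifs with hk
  · rw [hk, h]
  · rfl

theorem flipValue_le (x : HeightFun n) (i : ℕ) : flipValue x.val i ≤ x.val i + 1 := by
  rcases i with _ | i
  · have := x.succ_le 0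
    simp only [flipValue, zero_add] at *
    omega
  · have := x.succ_le (i + 1)
    have := x.le_succ i
    simp only [flipValue]
    omega

theorem le_flipValue (x : HeightFun n) (i : ℕ) : x.val i ≤ flipValue x.val i + 1 := by
  rcases i with _ | i
  · have := x.le_succ 0
    simp only [flipValue, zero_add] at *
    omega
  · have := x.le_succ (i + 1)
    have := x.succ_le i
    simp only [flipValue]
    omega

theorem flip_cases (i : Fin n) (x : HeightFun n) : flip i x = x ∨
    (x < flip i x ∧ (flip i x).rank = x.rank + 1) ∨
    (flip i x < x ∧ x.rank = (flip i x).rank + 1) := by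
  have h₁ := x.flipValue_le i
  have h₂ := x.le_flipValue i
  have h₃ := rank_flip i x
  rcases lt_trichotomy (x.val i) (flipValue x.val i) with h | h | h
  · exact Or.inr (Or.inl ⟨(le_flip h.le).lt_of_ne (flip_ne h.ne).symm, by omega⟩)
  · exact Or.inl (flip_eq h)
  · exact Or.inr (Or.inr ⟨(flip_le le_rfl h.le).lt_of_ne (flip_ne h.ne'), by omega⟩)

theorem flipValue_of_lt_flip {i : Fin n} {x : HeightFun n} (h : x < flip i x) :
    flipValue x.val i = x.val i + 1 := by
  have h₁ := x.flipValue_le i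
  have h₂ := val_le_val h.le i
  rw [flip_val_self] at h₂
  by_contra hne
  exact h.ne' (flip_eq (by omega))

/-- An upward flip needs `x.val i = x.val (i + 1)`, so the height of `y` at `i + 1` is squeezed
between equal values. The equality at `i + 1` is what carries the parity test from `x` to `y` in
`flipMod_mono`. -/
theorem flipValue_mono {i : ℕ} {x y : HeightFun n} (hxy : x ≤ y)
    (hx : flipValue x.val i = x.val i + 1) (hi : y.val i = x.val i) :
    y.val (i + 1) = x.val (i + 1) ∧ flipValue y.val i = y.val i + 1 := by
  have h₁ := val_le_val hxy (i + 1)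
  have h₂ := y.succ_le i
  rcases i with _ | i
  · simp only [flipValue, zero_add] at *
    omega
  · have h₃ := x.succ_le (i + 1)
    have h₄ := x.le_succ i
    have h₅ := val_le_val hxy i
    have h₆ := y.le_succ i
    simp only [flipValue] at *
    omega

theorem flip_mono {i : Fin n} {x y : HeightFun n} (hxy : x ≤ y) (hx : x < flip i x) :
    flip i x ≤ y ∨ flip i x ≤ flip i y := by
  have h := flipValue_of_lt_flip hx
  by_cases hi : y.val i = x.val i
  · right
    have h' := (flipValue_mono hxy h hi).2
    rw [le_def]
    intro k
    rw [flip_val, flip_val]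
    split_ifs
    · omega
    · exact hxy k
  · have := val_le_val hxy i
    exact Or.inl (flip_le hxy (by omega))

theorem exists_flip_le {x y : HeightFun n} (h : x < y) :
    ∃ i : Fin n, x < flip i x ∧ flip i x ≤ y := by
  classical
  -- If there were no such index, downward induction from `n` would give `y ≤ x`: where `x` drops by
  -- one, `y` drops by at most one.
  have hex : ∃ i, x.val i = x.val (i + 1) ∧ x.val i < y.val i := by
    by_contra! hn
    have key (d : ℕ) : ∀ i, n - i = d → y.val i ≤ x.val i := by
      induction d with
      | zero =>
        intro i hi
        rw [x.eq_zero i (by omega), y.eq_zero i (by omega)]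
      | succ d ih =>
        intro i hi
        have h₁ := ih (i + 1) (by omega)
        have h₂ := x.succ_le i
        have h₃ := y.le_succ i
        have h₄ := hn i
        omega
    exact h.not_ge fun i ↦ key _ i rfl
  obtain ⟨h₁, h₂⟩ := Nat.find_spec hex
  have hmin (j : ℕ) (hj : j < Nat.find hex) := Nat.find_min hex hj
  generalize Nat.find hex = i at h₁ h₂ hmin
  have hi : i < n := by
    by_contra hi
    rw [x.eq_zero i (by omega), y.eq_zero i (by omega)] at h₂
    exact h₂.false
  -- By minimality of `i`, the height of `x` drops just before `i`: otherwise the preceding index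
  -- would qualify too, as `y` is non-increasing. So the flip goes up.
  have hv : flipValue x.val i = x.val i + 1 := by
    rcases i with _ | i
    · simp only [flipValue, zero_add] at *
      omega
    · have h₃ := hmin i (by omega)
      have h₄ := x.succ_le i
      have h₅ := x.le_succ i
      have h₆ := y.succ_le i
      simp only [flipValue]
      omega
  refine ⟨⟨i, hi⟩, (le_flip (by simp [hv])).lt_of_ne (flip_ne (by simp [hv])).symm,
    flip_le h.le ?_⟩
  simp only [hv]
  omega

theorem flipMod_cases (p : ℤ) (i : Fin n) (x : HeightFun n) : flipMod p i x = x ∨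
    (x < flipMod p i x ∧ (flipMod p i x).rank = x.rank + 1) ∨
    (flipMod p i x < x ∧ x.rank = (flipMod p i x).rank + 1) := by
  unfold flipMod
  split_ifs
  · exact flip_cases i x
  · exact Or.inl rfl

theorem flipMod_mono {p : ℤ} {i : Fin n} {x y : HeightFun n} (hxy : x ≤ y)
    (hx : x < flipMod p i x) : flipMod p i x ≤ y ∨ flipMod p i x ≤ flipMod p i y := by
  unfold flipMod at *
  by_cases h : x.val (i + 1) % 2 = p
  · rw [if_pos h] at hx ⊢
    by_cases hi : y.val i = x.val i
    · rw [(flipValue_mono hxy (flipValue_of_lt_flip hx) hi).1, if_pos h]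
      exact flip_mono hxy hx
    · have h₁ := flipValue_of_lt_flip hx
      have := val_le_val hxy i
      exact Or.inl (flip_le hxy (by omega))
  · rw [if_neg h] at hx
    exact absurd rfl hx.ne

/-- The number of elements of a list that are at least `i`. -/
def countGE (ks : List (Fin n)) (i : ℕ) : ℕ :=
  ks.countP fun k : Fin n ↦ i ≤ k

@[simp]
theorem countGE_nil (i : ℕ) : countGE ([] : List (Fin n)) i = 0 :=
  rfl

theorem countGE_cons (k : Fin n) (ks : List (Fin n)) (i : ℕ) :
    countGE (k :: ks) i = countGE ks i + if i ≤ (k : ℕ) then 1 else 0 := by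
  simp [countGE, List.countP_cons]

theorem countGE_append (ks ls : List (Fin n)) (i : ℕ) :
    countGE (ks ++ ls) i = countGE ks i + countGE ls i := by
  simp [countGE]

theorem countGE_eq_length {ks : List (Fin n)} {i : ℕ} (h : ∀ k ∈ ks, i ≤ (k : ℕ)) :
    countGE ks i = ks.length := by
  rw [countGE, List.countP_eq_length]
  simpa using h

theorem countGE_succ {ks : List (Fin n)} (h : ks.Pairwise (· > ·)) (i : ℕ) :
    countGE ks i = countGE ks (i + 1) + if i ∈ ks.map Fin.val then 1 else 0 := by
  induction ks with
  | nil => simp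
  | cons k ks ih =>
    obtain ⟨h₁, h₂⟩ := List.pairwise_cons.mp h
    rw [countGE_cons, countGE_cons, ih h₂]
    have h₃ : ∀ l ∈ ks.map Fin.val, l < k := by simpa using h₁
    have h₄ := h₃ i
    simp only [List.map_cons, List.mem_cons]
    split_ifs <;> grind

/-- The height function of a decreasing list. -/
def ofList (ks : List (Fin n)) (h : ks.Pairwise (· > ·)) : HeightFun n where
  val i := countGE ks i
  succ_le i := by
    rw [countGE_succ h i]
    split_ifs <;> simp
  le_succ i := by
    rw [countGE_succ h i]
    split_ifs <;> simp
  eq_zero i hi := by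
    rw [Int.natCast_eq_zero, countGE, List.countP_eq_zero]
    intro k _
    have := k.2
    simp only [decide_eq_true_eq]
    omega

theorem ofList_val (ks : List (Fin n)) (h : ks.Pairwise (· > ·)) (i : ℕ) :
    (ofList ks h).val i = countGE ks i :=
  rfl

theorem ofList_injective {ks ls : List (Fin n)} (h : ks.Pairwise (· > ·))
    (h' : ls.Pairwise (· > ·)) (heq : ofList ks h = ofList ls h') : ks = ls := by
  have hc (i : ℕ) : countGE ks i = countGE ls i := by
    have := congrArg (fun x ↦ x.val i) heq
    simpa [ofList_val] using this
  have hm (k : Fin n) : k ∈ ks ↔ k ∈ ls := by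
    have h₁ := countGE_succ h k
    have h₂ := countGE_succ h' k
    rw [hc, hc, h₂] at h₁
    simp only [List.mem_map, Fin.val_inj, exists_eq_right, Nat.add_left_cancel_iff] at h₁
    split_ifs at h₁ <;> simp_all
  exact List.Subset.antisymm_of_sortedGT (fun k hk ↦ (hm k).mp hk) (fun k hk ↦ (hm k).mpr hk)
    h.sortedGT h'.sortedGT

/-- Double counting: the element `k` contributes one to each of the heights at 0, …, k. -/
theorem rank_ofList (ks : List (Fin n)) (h : ks.Pairwise (· > ·)) :
    (ofList ks h).rank = (ks.map fun k : Fin n ↦ (k : ℕ) + 1).sum := by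
  rw [rank]
  simp only [ofList_val]
  rw [← Nat.cast_sum, Int.toNat_natCast]
  clear h
  induction ks with
  | nil => simp
  | cons k ks ih =>
    simp only [countGE_cons, Finset.sum_add_distrib, ih, List.map_cons, List.sum_cons]
    rw [add_comm, Nat.add_right_cancel_iff, Finset.sum_boole]
    have : (Finset.range n).filter (fun i ↦ i ≤ (k : ℕ)) = Finset.range (k + 1) := by
      ext i
      have := k.2
      simp only [Finset.mem_filter, Finset.mem_range]
      omega
    simp [this]

theorem flip_ofList_zero {ks : List (Fin n)} (h : ks.Pairwise (· > ·)) {k : Fin n}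
    (hk : (k : ℕ) = 0) (h' : (ks ++ [k]).Pairwise (· > ·)) :
    flip k (ofList ks h) = ofList (ks ++ [k]) h' := by
  have hlt : ∀ l ∈ ks, k < l := by simpa using (List.pairwise_append.mp h').2.2
  ext i
  rw [flip_val]
  by_cases hi : i = k
  · subst hi
    have h₀ : countGE ks 0 = ks.length := countGE_eq_length fun l hl ↦ Nat.zero_le _
    have h₁ : countGE ks 1 = ks.length := countGE_eq_length fun l hl ↦ by
      have := hlt l hl
      omega
    rw [if_pos rfl, hk, flipValue]
    simp only [ofList_val, countGE_append, countGE_cons, countGE_nil]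
    rw [h₀, h₁, if_pos (Nat.zero_le _)]
    push_cast
    ring
  · rw [if_neg hi, ofList_val, ofList_val, countGE_append, countGE_cons, countGE_nil,
      if_neg (by omega)]
    simp

theorem flip_ofList_succ {ks : List (Fin n)} {k l : Fin n} (hl : (l : ℕ) = k + 1)
    (h : (ks ++ [k]).Pairwise (· > ·)) (h' : (ks ++ [l]).Pairwise (· > ·)) :
    flip l (ofList (ks ++ [k]) h) = ofList (ks ++ [l]) h' := by
  have hlt : ∀ j ∈ ks, l < j := by simpa using (List.pairwise_append.mp h').2.2
  ext i
  rw [flip_val]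
  by_cases hi : i = l
  · subst hi
    have h₀ (i : ℕ) (hi : i ≤ k + 2) : countGE ks i = ks.length :=
      countGE_eq_length fun j hj ↦ by
        have := hlt j hj
        omega
    rw [if_pos rfl, hl, flipValue]
    simp only [ofList_val, countGE_append, countGE_cons, countGE_nil]
    rw [h₀ _ (by omega), h₀ _ (by omega), h₀ _ (by omega), if_pos le_rfl, if_neg (by omega),
      if_neg (by omega), if_pos (by omega)]
    push_cast
    ring
  · rw [if_neg hi]
    simp only [ofList_val, countGE_append, countGE_cons, countGE_nil]
    have : (i ≤ (k : ℕ)) ↔ (i ≤ (l : ℕ)) := by omega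
    simp [this]

end HeightFun

end BruhatQuotient

/-! ### Normal words, their products and their action on the empty set -/

namespace BruhatQuotient

section Involutions

variable {G : Type*} [Monoid G] {a b : G}

theorem mul_pow_two_eq_one (ha : a * a = 1) (hb : b * b = 1) (h : a * b = b * a) :
    (a * b) ^ 2 = 1 := by
  rw [pow_two]
  nth_rw 2 [h]
  rw [mul_assoc, ← mul_assoc b, hb, one_mul, ha]

theorem mul_pow_three_eq_one (ha : a * a = 1) (hb : b * b = 1) (h : a * b * a = b * a * b) :
    (a * b) ^ 3 = 1 := by
  calc (a * b) ^ 3 = a * b * a * (b * a * b) := by simp only [pow_succ, pow_zero, one_mul, mul_assoc]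
    _ = b * a * b * (b * a * b) := by rw [h]
    _ = b * (a * (b * b) * a) * b := by simp only [mul_assoc]
    _ = 1 := by rw [hb, mul_one, ha, mul_one, hb]

theorem mul_pow_four_eq_one (ha : a * a = 1) (hb : b * b = 1)
    (h : a * b * a * b = b * a * b * a) : (a * b) ^ 4 = 1 := by
  calc (a * b) ^ 4 = a * b * a * b * (a * b * a * b) := by
        simp only [pow_succ, pow_zero, one_mul, mul_assoc]
    _ = a * b * a * b * (b * a * b * a) := by rw [h]
    _ = a * (b * (a * (b * b) * a) * b) * a := by simp only [mul_assoc]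
    _ = 1 := by rw [hb, mul_one, ha, mul_one, hb, mul_one, ha]

theorem comm_of_mul_pow_two {G : Type*} [Group G] {a b : G} (ha : a * a = 1) (hb : b * b = 1)
    (h : (a * b) ^ 2 = 1) : a * b = b * a := by
  have h₁ := eq_inv_of_mul_eq_one_left ha
  have h₂ := eq_inv_of_mul_eq_one_left hb
  have h₃ := eq_inv_of_mul_eq_one_left ((pow_two (a * b)).symm.trans h)
  rwa [mul_inv_rev, ← h₁, ← h₂] at h₃

theorem braid_of_mul_pow_three {G : Type*} [Group G] {a b : G} (ha : a * a = 1) (hb : b * b = 1)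
    (h : (a * b) ^ 3 = 1) : a * b * a = b * a * b := by
  have h₁ := eq_inv_of_mul_eq_one_left ha
  have h₂ := eq_inv_of_mul_eq_one_left hb
  have h₃ : a * b * a * (b * a * b) = 1 := by
    rw [← h]
    simp only [pow_succ, pow_zero, one_mul, mul_assoc]
  have h₄ := eq_inv_of_mul_eq_one_left h₃
  rwa [mul_inv_rev, mul_inv_rev, ← h₁, ← h₂, ← mul_assoc] at h₄

theorem braid_of_mul_pow_four {G : Type*} [Group G] {a b : G} (ha : a * a = 1) (hb : b * b = 1)
    (h : (a * b) ^ 4 = 1) : a * b * a * b = b * a * b * a := by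
  have h₁ := eq_inv_of_mul_eq_one_left ha
  have h₂ := eq_inv_of_mul_eq_one_left hb
  have h₃ : a * b * a * b * (a * b * a * b) = 1 := by
    rw [← h]
    simp only [pow_succ, pow_zero, one_mul, mul_assoc]
  have h₄ := eq_inv_of_mul_eq_one_left h₃
  rw [mul_inv_rev, mul_inv_rev, mul_inv_rev, ← h₁, ← h₂] at h₄
  simpa only [mul_assoc] using h₄

end Involutions

variable {n : ℕ}

theorem descWord_zero (h : 0 < n) : descWord (⟨0, h⟩ : Fin n) = [⟨0, h⟩] := by
  rw [descWord, ← List.reverse_singleton, List.reverse_inj]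
  apply List.SortedLT.eq_of_mem_iff
  · exact ((List.sortedLT_finRange n).pairwise.filter _).sortedLT
  · exact (List.pairwise_singleton _ _).sortedLT
  · intro a
    simp [Fin.le_def, Fin.ext_iff]

theorem descWord_succ {k : ℕ} (h : k + 1 < n) :
    descWord (⟨k + 1, h⟩ : Fin n) = ⟨k + 1, h⟩ :: descWord ⟨k, by omega⟩ := by
  rw [descWord, descWord, ← List.reverse_concat, List.reverse_inj]
  apply List.SortedLT.eq_of_mem_iff
  · exact ((List.sortedLT_finRange n).pairwise.filter _).sortedLT
  · apply List.Pairwise.sortedLT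
    rw [List.pairwise_append]
    refine ⟨(List.sortedLT_finRange n).pairwise.filter _, List.pairwise_singleton _ _, ?_⟩
    simp only [List.mem_filter, List.mem_finRange, Fin.le_def, Fin.lt_def, List.mem_singleton,
      decide_eq_true_eq]
    rintro a ⟨-, ha⟩ b rfl
    simp only
    omega
  · intro a
    simp only [List.mem_filter, List.mem_finRange, Fin.le_def, Fin.ext_iff,
      List.mem_append, true_and, List.mem_singleton, decide_eq_true_eq]
    omega

theorem normalWord_cons (k : Fin n) (ks : List (Fin n)) :
    normalWord (k :: ks) = normalWord ks ++ descWord k := by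
  simp [normalWord]

/-- The word obtained by `alternate` from `ω` as a prefix of a word in which `s_1` occurs an even
number of times (for `p = true`) or an odd number of times (for `p = false`) to the right of `ω`. -/
def alternateFrom (p : Bool) : List (Fin n) → List (Fin (n + 1))
  | [] => []
  | i :: ω =>
    (if (i : ℕ) = 0 ∧ (Odd (ω.countP fun j : Fin n ↦ (j : ℕ) = 0) ↔ p = true) then 0 else i.succ) ::
      alternateFrom p ω

theorem alternate_eq_alternateFrom (ω : List (Fin n)) : alternate ω = alternateFrom true ω := by
  induction ω with
  | nil => rfl
  | cons i ω ih =>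
    -- The count in `alternate` elaborates with the whole list coerced to natural numbers; it agrees
    -- with the count over `Fin n`.
    have : (List.countP (fun j ↦ decide (j = 0)) do let a ← ω; pure (a : ℕ)) =
        ω.countP fun j : Fin n ↦ (j : ℕ) = 0 := by
      have hm : (do let a ← ω; pure (a : ℕ)) = ω.map Fin.val := by
        simp [List.map_eq_flatMap]
      rw [hm, List.countP_map]
      rfl
    rw [alternate, alternateFrom, ih, this]
    simp

theorem alternateFrom_append (p : Bool) (ω κ : List (Fin n)) :
    alternateFrom p (ω ++ κ) =
      alternateFrom (p ^^ decide (Odd (κ.countP fun j : Fin n ↦ (j : ℕ) = 0))) ω ++ alternateFrom p κ := by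
  induction ω with
  | nil => rfl
  | cons i ω ih =>
    simp only [List.cons_append, alternateFrom, ih, List.countP_append, List.cons.injEq, and_true]
    congr 1
    by_cases h₁ : Odd (κ.countP fun j : Fin n ↦ (j : ℕ) = 0) <;> cases p <;>
      simp [h₁, Nat.odd_add, ← Nat.not_odd_iff_even]

theorem countP_descWord (k : Fin n) : (descWord k).countP (fun j : Fin n ↦ (j : ℕ) = 0) = 1 := by
  obtain ⟨k, hk⟩ := k
  induction k with
  | zero => simp [descWord_zero]
  | succ k ih => simp [descWord_succ hk, ih]

theorem length_descWord (k : Fin n) : (descWord k).length = k + 1 := by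
  obtain ⟨k, hk⟩ := k
  induction k with
  | zero => simp [descWord_zero]
  | succ k ih => simp [descWord_succ hk, ih]

theorem length_normalWord (ks : List (Fin n)) :
    (normalWord ks).length = (ks.map fun k : Fin n ↦ (k : ℕ) + 1).sum := by
  induction ks with
  | nil => rfl
  | cons k ks ih => simp [normalWord_cons, ih, length_descWord, add_comm]

theorem length_alternate (ω : List (Fin n)) : (alternate ω).length = ω.length := by
  induction ω with
  | nil => rfl
  | cons i ω ih => simp [alternate, ih]

section GeneratorSequence

variable {G : Type*} [Group G]

/-- The extension by `1` of a finite sequence of group elements. -/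
def extendOne (f : Fin n → G) (i : ℕ) : G :=
  if h : i < n then f ⟨i, h⟩ else 1

@[simp]
theorem extendOne_val (f : Fin n → G) (i : Fin n) : extendOne f i = f i := by
  simp [extendOne]

theorem extendOne_of_lt (f : Fin n → G) {i : ℕ} (h : i < n) : extendOne f i = f ⟨i, h⟩ := by
  simp [extendOne, h]

theorem prod_map_descWord (f : Fin n → G) (x : G) (hx : ∀ i : Fin n, (i : ℕ) = 0 → f i = x)
    (k : Fin n) : ((descWord k).map f).prod = descProd (extendOne f) x k := by
  obtain ⟨k, hk⟩ := k
  induction k with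
  | zero => simpa [descWord_zero, descProd] using hx ⟨0, hk⟩ rfl
  | succ k ih =>
    rw [descWord_succ, List.map_cons, List.prod_cons, ih]
    simp [descProd, extendOne_of_lt f hk]

theorem prod_map_normalWord (f : Fin n → G) (x : G) (hx : ∀ i : Fin n, (i : ℕ) = 0 → f i = x)
    (ε : Bool) (ks : List (Fin n)) :
    ((normalWord ks).map f).prod =
      normalProd (extendOne f) (fun _ ↦ x) ε (ks.map Fin.val) := by
  induction ks generalizing ε with
  | nil => rfl
  | cons k ks ih =>
    rw [normalWord_cons, List.map_append, List.prod_append, ih (!ε), prod_map_descWord f x hx,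
      List.map_cons, normalProd]

theorem prod_map_alternateFrom_descWord (f : Fin (n + 1) → G) (e : Bool → G)
    (h₀ : f 0 = e false) (h₁ : ∀ i : Fin n, (i : ℕ) = 0 → f i.succ = e true)
    (ε : Bool) (k : Fin n) : ((alternateFrom ε (descWord k)).map f).prod =
      descProd (extendOne fun i ↦ f i.succ) (e ε) k := by
  obtain ⟨k, hk⟩ := k
  induction k with
  | zero =>
    cases ε
    · simp [descWord_zero, descProd, alternateFrom, h₀]
    · simpa [descWord_zero, descProd, alternateFrom] using h₁ ⟨0, hk⟩ rfl
  | succ k ih =>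
    rw [descWord_succ, alternateFrom, List.map_cons, List.prod_cons, ih]
    simp [descProd, extendOne_of_lt _ hk]

/-- Every descending word contains s_1 exactly once, so alternating over the occurrences of s_1 is
alternating over the factors of `normalProd`. -/
theorem prod_map_alternateFrom_normalWord (f : Fin (n + 1) → G) (e : Bool → G)
    (h₀ : f 0 = e false) (h₁ : ∀ i : Fin n, (i : ℕ) = 0 → f i.succ = e true)
    (ε : Bool) (ks : List (Fin n)) : ((alternateFrom ε (normalWord ks)).map f).prod =
      normalProd (extendOne fun i ↦ f i.succ) e ε (ks.map Fin.val) := by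
  induction ks generalizing ε with
  | nil => rfl
  | cons k ks ih =>
    rw [normalWord_cons, alternateFrom_append, List.map_append, List.prod_append, countP_descWord,
      prod_map_alternateFrom_descWord f e h₀ h₁, List.map_cons, normalProd]
    simp [ih]

theorem normalProd_append (s : ℕ → G) (e : Bool → G) (ε : Bool) (ks : List ℕ) (k : ℕ) :
    normalProd s e ε (ks ++ [k]) =
      descProd s (e (ε ^^ decide (Odd ks.length))) k * normalProd s e ε ks := by
  induction ks generalizing ε with
  | nil => simp [normalProd]
  | cons l ks ih =>
    rw [List.cons_append, normalProd, ih, normalProd, mul_assoc]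
    congr 3
    by_cases h : Odd ks.length <;> cases ε <;> simp [h, Nat.odd_add_one]

/-- The element 0 is inserted by `x` and then raised one step at a time up to `k`; nothing is in the
way, since the elements present are larger than `k`. -/
theorem act_descProd (φ : G →* Function.End (HeightFun n)) (f : Fin n → G) (x : G)
    (hf : ∀ i : Fin n, (i : ℕ) ≠ 0 → ∀ x, φ (f i) x = HeightFun.flip i x)
    {ks : List (Fin n)} (hks : ks.Pairwise (· > ·))
    (hx : ∀ i : Fin n, (i : ℕ) = 0 → (∀ l ∈ ks, i < l) →
      φ x (HeightFun.ofList ks hks) = HeightFun.flip i (HeightFun.ofList ks hks))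
    {k : Fin n} (h : (ks ++ [k]).Pairwise (· > ·)) :
    φ (descProd (extendOne f) x k) (HeightFun.ofList ks hks) =
      HeightFun.ofList (ks ++ [k]) h := by
  obtain ⟨k, hk⟩ := k
  induction k with
  | zero =>
    rw [descProd, hx ⟨0, hk⟩ rfl, HeightFun.flip_ofList_zero hks rfl h]
    simpa using (List.pairwise_append.mp h).2.2
  | succ k ih =>
    have h' : (ks ++ [(⟨k, by omega⟩ : Fin n)]).Pairwise (· > ·) := by
      rw [List.pairwise_append] at h ⊢
      refine ⟨h.1, List.pairwise_singleton _ _, ?_⟩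
      have := h.2.2
      simp only [List.mem_singleton, forall_eq, gt_iff_lt, Fin.lt_def] at this ⊢
      intro a ha
      have := this a ha
      omega
    rw [descProd, map_mul]
    change φ (extendOne f (k + 1)) (φ (descProd (extendOne f) x k) _) = _
    rw [ih (by omega) h', extendOne_of_lt f hk, hf _ (by simp),
      HeightFun.flip_ofList_succ (by simp) h' h]

theorem act_normalProd (φ : G →* Function.End (HeightFun n)) (f : Fin n → G) (e : Bool → G)
    (hf : ∀ i : Fin n, (i : ℕ) ≠ 0 → ∀ x, φ (f i) x = HeightFun.flip i x)
    (he : ∀ i : Fin n, (i : ℕ) = 0 → ∀ ε, ∀ x : HeightFun n,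
      (x.val (i + 1) % 2 = if ε then 0 else 1) → φ (e ε) x = HeightFun.flip i x)
    (ks : List (Fin n)) (hks : ks.Pairwise (· > ·)) :
    φ (normalProd (extendOne f) e true (ks.map Fin.val)) (HeightFun.zero n) =
      HeightFun.ofList ks hks := by
  induction ks using List.reverseRecOn with
  | nil =>
    rw [List.map_nil, normalProd, map_one]
    rfl
  | append_singleton ks k ih =>
    rw [List.map_append, List.map_singleton, normalProd_append, map_mul]
    change φ _ (φ _ _) = _
    have hks' := (List.pairwise_append.mp hks).1
    rw [ih hks']
    refine act_descProd φ f _ hf hks' (fun i hi hlt ↦ he i hi _ _ ?_) hks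
    -- All elements present are positive, so the height at 1 is their number, whose parity also
    -- selects the generator.
    rw [HeightFun.ofList_val, HeightFun.countGE_eq_length (i := i + 1) fun l hl ↦ by
      have := hlt l hl
      omega]
    rw [List.length_map]
    by_cases h : Odd ks.length
    · simp only [h, decide_true, Bool.xor_true, Bool.not_true]
      have := Nat.odd_iff.mp h
      simp only [Bool.false_eq_true, if_false]
      omega
    · simp only [h, decide_false, Bool.xor_false, if_true]
      have := Nat.not_odd_iff.mp h
      omega

end GeneratorSequence

end BruhatQuotient

/-! ### The models for the types B_n and D_{n+1} -/

namespace BruhatQuotient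

open CoxeterSystem HeightFun

variable {n : ℕ}

theorem matB_self (i : Fin n) : matB n i i = 1 :=
  (matB n).diagonal i

theorem matB_zero_one {i j : Fin n} (hi : (i : ℕ) = 0) (hj : (j : ℕ) = 1) : matB n i j = 4 := by
  simp [matB, hi, hj, Fin.ext_iff]

theorem matB_succ {i j : Fin n} (hi : (i : ℕ) ≠ 0) (hj : (i : ℕ) + 1 = j) : matB n i j = 3 := by
  simp only [matB, Matrix.of_apply, Fin.ext_iff]
  split_ifs <;> omega

theorem matB_of_lt {i j : Fin n} (h : (i : ℕ) + 1 < j) : matB n i j = 2 := by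
  simp only [matB, Matrix.of_apply, Fin.ext_iff]
  split_ifs <;> omega

theorem matD_zero_two {j : Fin n} (hj : (j : ℕ) = 1) : matD n 0 j.succ = 3 := by
  simp only [matD, Matrix.of_apply, Fin.ext_iff, Fin.val_zero, Fin.val_succ]
  grind

theorem matD_zero_of_ne {j : Fin n} (hj : (j : ℕ) ≠ 1) : matD n 0 j.succ = 2 := by
  simp only [matD, Matrix.of_apply, Fin.ext_iff, Fin.val_zero, Fin.val_succ]
  grind

theorem matD_succ {i j : Fin n} (h : (i : ℕ) + 1 = j) : matD n i.succ j.succ = 3 := by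
  simp only [matD, Matrix.of_apply, Fin.ext_iff, Fin.val_succ]
  grind

theorem matD_of_lt {i j : Fin n} (h : (i : ℕ) + 1 < j) : matD n i.succ j.succ = 2 := by
  simp only [matD, Matrix.of_apply, Fin.ext_iff, Fin.val_succ]
  grind

/-- The action of the generators of the group of type `B_n` on height functions. -/
def flipEnd (i : Fin n) : Function.End (HeightFun n) :=
  flip i

/-- The action of `t_1` and `t_0` on height functions. -/
def flipModEnd (p : ℤ) (i : Fin n) : Function.End (HeightFun n) :=
  flipMod p i

theorem flipEnd_mul_self (i : Fin n) : flipEnd i * flipEnd i = 1 :=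
  funext (flip_flip i)

theorem flipModEnd_mul_self (p : ℤ) (i : Fin n) : flipModEnd p i * flipModEnd p i = 1 :=
  funext (flipMod_flipMod p i)

/-- If `M` has relations of the kind `(i, j)`, then it has those of the kind `(j, i)`. -/
theorem mul_pow_eq_one_symm {B : Type*} (M : CoxeterMatrix B) {G : Type*} [Monoid G]
    {f : B → G} (hf : ∀ i, f i * f i = 1) {i j : B} (h : (f i * f j) ^ M i j = 1) :
    (f j * f i) ^ M j i = 1 := by
  have h₁ : f i * (f j * f i) ^ M i j = (f i * f j) ^ M i j * f i := by
    have : SemiconjBy (f i) (f j * f i) (f i * f j) := by simp [SemiconjBy, mul_assoc]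
    exact (this.pow_right _).eq
  rw [M.symmetric, ← one_mul ((f j * f i) ^ M i j), ← hf i, mul_assoc, h₁, h, one_mul, hf]

theorem isLiftable_flipEnd : (matB n).IsLiftable (flipEnd : Fin n → _) := by
  have key {i j : Fin n} (hij : i < j) : (flipEnd i * flipEnd j) ^ matB n i j = 1 := by
    have hi := flipEnd_mul_self i
    have hj := flipEnd_mul_self j
    rcases (show (i : ℕ) + 1 ≤ j from hij).eq_or_lt with h | h
    · by_cases h₀ : (i : ℕ) = 0
      · rw [matB_zero_one h₀ (by omega)]
        exact mul_pow_four_eq_one hi hj (funext (flip_braid_zero h₀ (by omega)))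
      · rw [matB_succ h₀ h]
        exact mul_pow_three_eq_one hi hj (funext (flip_braid h₀ h))
    · rw [matB_of_lt h]
      exact mul_pow_two_eq_one hi hj (funext (flip_comm h))
  intro i j
  rcases lt_trichotomy i j with h | rfl | h
  · exact key h
  · rw [matB_self, pow_one, flipEnd_mul_self]
  · exact mul_pow_eq_one_symm _ flipEnd_mul_self (key h)

/-- The action of the generators of the group of type `D_{n + 1}` on height functions. -/
def flipD (z : Fin n) : Fin (n + 1) → Function.End (HeightFun n) :=
  Fin.cons (flipModEnd 1 z) fun i ↦ if i = z then flipModEnd 0 z else flipEnd i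

theorem flipD_zero (z : Fin n) : flipD z 0 = flipModEnd 1 z :=
  rfl

theorem flipD_succ_self (z : Fin n) : flipD z z.succ = flipModEnd 0 z := by
  simp [flipD]

theorem flipD_succ {z i : Fin n} (h : i ≠ z) : flipD z i.succ = flipEnd i := by
  simp [flipD, h]

theorem flipD_mul_self (z : Fin n) (i : Fin (n + 1)) : flipD z i * flipD z i = 1 := by
  refine Fin.cases (flipModEnd_mul_self 1 z) (fun i ↦ ?_) i
  by_cases h : i = z
  · rw [h, flipD_succ_self, flipModEnd_mul_self]
  · rw [flipD_succ h, flipEnd_mul_self]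

theorem isLiftable_flipD {z : Fin n} (hz : (z : ℕ) = 0) : (matD n).IsLiftable (flipD z) := by
  have hne {i : Fin n} (h : (i : ℕ) ≠ 0) : i ≠ z := by
    rintro rfl
    exact h hz
  have key₀ (j : Fin n) : (flipD z 0 * flipD z j.succ) ^ matD n 0 j.succ = 1 := by
    have h₀ := flipD_mul_self z 0
    have hj := flipD_mul_self z j.succ
    by_cases h₁ : (j : ℕ) = 1
    · rw [matD_zero_two h₁]
      refine mul_pow_three_eq_one h₀ hj ?_
      rw [flipD_zero, flipD_succ (hne (by omega))]
      exact funext (flipMod_braid (Or.inr rfl) hz h₁)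
    · rw [matD_zero_of_ne h₁]
      refine mul_pow_two_eq_one h₀ hj ?_
      by_cases h₂ : j = z
      · rw [flipD_zero, h₂, flipD_succ_self]
        exact funext (flipMod_comm 1 0 z)
      · rw [flipD_zero, flipD_succ h₂]
        refine funext (flipMod_flip_comm 1 ?_)
        rw [Fin.ext_iff] at h₂
        omega
  have key {i j : Fin n} (hij : i < j) :
      (flipD z i.succ * flipD z j.succ) ^ matD n i.succ j.succ = 1 := by
    have hi := flipD_mul_self z i.succ
    have hj := flipD_mul_self z j.succ
    have hjz : j ≠ z := hne (by omega)
    rw [flipD_succ hjz] at hj ⊢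
    by_cases hiz : i = z
    · subst hiz
      rw [flipD_succ_self] at hi ⊢
      rcases (show (i : ℕ) + 1 ≤ j from hij).eq_or_lt with h | h
      · rw [matD_succ h]
        exact mul_pow_three_eq_one hi hj (funext (flipMod_braid (Or.inl rfl) hz (by omega)))
      · rw [matD_of_lt h]
        exact mul_pow_two_eq_one hi hj (funext (flipMod_flip_comm 0 h))
    · rw [flipD_succ hiz] at hi ⊢
      rcases (show (i : ℕ) + 1 ≤ j from hij).eq_or_lt with h | h
      · rw [matD_succ h]
        refine mul_pow_three_eq_one hi hj (funext (flip_braid ?_ h))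
        rw [Fin.ext_iff] at hiz
        omega
      · rw [matD_of_lt h]
        exact mul_pow_two_eq_one hi hj (funext (flip_comm h))
  intro i j
  cases i using Fin.cases with
  | zero =>
    cases j using Fin.cases with
    | zero => rw [(matD n).diagonal, pow_one, flipD_mul_self]
    | succ j => exact key₀ j
  | succ i =>
    cases j using Fin.cases with
    | zero => exact mul_pow_eq_one_symm _ (flipD_mul_self z) (key₀ i)
    | succ j =>
      rcases lt_trichotomy i j with h | rfl | h
      · exact key h
      · rw [(matD n).diagonal, pow_one, flipD_mul_self]
      · exact mul_pow_eq_one_symm _ (flipD_mul_self z) (key h)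

variable {W : Type*} [Group W]

theorem normalFormRelations_B (cs : CoxeterSystem (matB n) W) {z : Fin n} (hz : (z : ℕ) = 0) :
    NormalFormRelations n (extendOne cs.simple) (fun _ ↦ cs.simple z) fun _ ↦ ∅ := by
  have hsq := cs.simple_mul_simple_self
  have hcomm {i j : Fin n} (h : (i : ℕ) + 1 < j) :
      cs.simple i * cs.simple j = cs.simple j * cs.simple i :=
    comm_of_mul_pow_two (hsq i) (hsq j) (matB_of_lt h ▸ cs.simple_mul_simple_pow i j)
  constructor
  · intro i _ h
    rw [extendOne_of_lt _ h, hsq]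
  · intro i j _ h hj
    rw [extendOne_of_lt _ hj, extendOne_of_lt _ (by omega)]
    exact hcomm h
  · intro i hi h
    rw [extendOne_of_lt _ h, extendOne_of_lt _ (by omega)]
    refine braid_of_mul_pow_three (hsq _) (hsq _) ?_
    have := cs.simple_mul_simple_pow ⟨i, by omega⟩ ⟨i + 1, h⟩
    rwa [matB_succ (by simp only; omega) (by simp)] at this
  · exact fun _ ↦ hsq z
  · intro _ i hi h
    rw [extendOne_of_lt _ h]
    exact (hcomm (by simp only; omega)).symm
  · intro _ h
    -- The relation of order 4 between s_1 and s_2, read with s_2 as the generator that passes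
    -- through.
    refine ⟨extendOne cs.simple 1, Or.inr rfl, ?_⟩
    rw [extendOne_of_lt _ h]
    refine (braid_of_mul_pow_four (hsq _) (hsq _) ?_).symm
    have := cs.simple_mul_simple_pow z ⟨1, h⟩
    rwa [matB_zero_one hz rfl] at this
  · simp
  · simp
  · simp

theorem normalFormRelations_D (cs : CoxeterSystem (matD n) W) {z : Fin n} (hz : (z : ℕ) = 0) :
    NormalFormRelations n (extendOne fun i ↦ cs.simple i.succ)
      (fun ε ↦ cs.simple (if ε then z.succ else 0))
      fun ε ↦ {cs.simple (if !ε then z.succ else 0)} := by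
  have hsq := cs.simple_mul_simple_self
  have hcomm {i j : Fin n} (h : (i : ℕ) + 1 < j) :
      cs.simple i.succ * cs.simple j.succ = cs.simple j.succ * cs.simple i.succ :=
    comm_of_mul_pow_two (hsq _) (hsq _) (matD_of_lt h ▸ cs.simple_mul_simple_pow i.succ j.succ)
  have hcomm₀ {j : Fin n} (h : (j : ℕ) ≠ 1) :
      cs.simple 0 * cs.simple j.succ = cs.simple j.succ * cs.simple 0 :=
    comm_of_mul_pow_two (hsq _) (hsq _) (matD_zero_of_ne h ▸ cs.simple_mul_simple_pow 0 j.succ)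
  have hcomm_last (ε : Bool) (i : ℕ) (hi : 2 ≤ i) (h : i < n) :
      extendOne (fun i ↦ cs.simple i.succ) i * cs.simple (if ε then z.succ else 0) =
        cs.simple (if ε then z.succ else 0) * extendOne (fun i ↦ cs.simple i.succ) i := by
    rw [extendOne_of_lt _ h]
    cases ε
    · exact (hcomm₀ (by simp only; omega)).symm
    · exact (hcomm (by simp only; omega)).symm
  have hbraid (ε : Bool) (h : 1 < n) :
      cs.simple (if ε then z.succ else 0) * extendOne (fun i ↦ cs.simple i.succ) 1 *
          cs.simple (if ε then z.succ else 0) =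
        extendOne (fun i ↦ cs.simple i.succ) 1 * cs.simple (if ε then z.succ else 0) *
          extendOne (fun i ↦ cs.simple i.succ) 1 := by
    rw [extendOne_of_lt _ h]
    refine braid_of_mul_pow_three (hsq _) (hsq _) ?_
    cases ε
    · exact matD_zero_two (n := n) (j := ⟨1, h⟩) rfl ▸ cs.simple_mul_simple_pow _ _
    · exact matD_succ (n := n) (i := z) (j := ⟨1, h⟩) (by simp [hz]) ▸
        cs.simple_mul_simple_pow _ _
  have hlast (ε : Bool) : cs.simple (if !ε then z.succ else 0) *
      cs.simple (if ε then z.succ else 0) = cs.simple (if ε then z.succ else 0) *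
        cs.simple (if !ε then z.succ else 0) := by
    cases ε
    · exact (hcomm₀ (by omega)).symm
    · exact hcomm₀ (by omega)
  constructor
  · intro i _ h
    rw [extendOne_of_lt _ h, hsq]
  · intro i j _ h hj
    rw [extendOne_of_lt _ hj, extendOne_of_lt _ (by omega)]
    exact hcomm h
  · intro i hi h
    rw [extendOne_of_lt _ h, extendOne_of_lt _ (by omega)]
    refine braid_of_mul_pow_three (hsq _) (hsq _) ?_
    have := cs.simple_mul_simple_pow (⟨i, by omega⟩ : Fin n).succ (⟨i + 1, h⟩ : Fin n).succ
    rwa [matD_succ (by simp)] at this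
  · exact fun _ ↦ hsq _
  · exact hcomm_last
  · intro ε h
    -- The generator that comes out is the other one of t_0 and t_1: one braid relation with t_2,
    -- after which t_0 and t_1 commute.
    refine ⟨_, Or.inl rfl, ?_⟩
    rw [← hbraid _ h, mul_assoc, hlast]
    simp only [mul_assoc]
  · rintro ε _ rfl
    exact hcomm_last _
  · rintro ε _ rfl h
    exact hbraid _ h
  · exact fun ε ↦ Or.inr ⟨rfl, hlast ε⟩

/-- The decreasing lists `k_1 > ⋯ > k_m`. -/
abbrev DecreasingList (n : ℕ) : Type :=
  {ks : List (Fin n) // ks.Pairwise (· > ·)}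

theorem exists_decreasingList_map_val {ks : List ℕ} (h : ks.Pairwise (· > ·))
    (hlt : ∀ k ∈ ks, k < n) : ∃ ls : DecreasingList n, ls.1.map Fin.val = ks := by
  refine ⟨⟨ks.attach.map fun k ↦ ⟨k.1, hlt k.1 k.2⟩, ?_⟩, by simp⟩
  exact List.Pairwise.of_map (S := (· > ·)) Fin.val (fun _ _ ↦ id) (by simpa using h)

/-- Height functions as a model of `B_n / A_{n - 1}`. -/
noncomputable def modelB (cs : CoxeterSystem (matB n) W) {z : Fin n} (hz : (z : ℕ) = 0) :
    QuotientModel cs {i : Fin n | (i : ℕ) ≠ 0} (DecreasingList n) (HeightFun n) where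
  act := cs.lift ⟨flipEnd, isLiftable_flipEnd⟩
  base := zero n
  rank := rank
  word ks := normalWord ks.1
  point ks := ofList ks.1 ks.2
  empty := ⟨[], List.Pairwise.nil⟩
  word_empty := rfl
  act_word ks := by
    rw [wordProd, prod_map_normalWord cs.simple (cs.simple z)
      (fun i hi ↦ by rw [Fin.ext (hi.trans hz.symm)]) true]
    refine act_normalProd _ _ _ (fun i _ x ↦ ?_) (fun i hi _ x _ ↦ ?_) _ _
    · rw [lift_apply_simple]
      rfl
    · rw [lift_apply_simple, Fin.ext (hi.trans hz.symm)]
      rfl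
  rank_mono := rank_mono
  point_injective _ _ h := Subtype.ext (ofList_injective _ _ h)
  length_word ks := by rw [rank_ofList, length_normalWord]
  act_base j hj := by
    rw [lift_apply_simple]
    refine flip_eq ?_
    obtain ⟨j | j, hj'⟩ := j
    · simp at hj
    · simp [flipValue]
  act_cases i x := by
    rw [lift_apply_simple]
    exact flip_cases i x
  act_mono i x y := by
    rw [lift_apply_simple]
    exact flip_mono
  exists_act_le x y h := by
    simp only [lift_apply_simple]
    exact exists_flip_le h
  simple_mul_word i ks := by
    have hx (i : Fin n) (hi : (i : ℕ) = 0) : cs.simple i = cs.simple z := by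
      rw [Fin.ext (hi.trans hz.symm)]
    have hrel := normalFormRelations_B cs hz
    have hp : (ks.1.map Fin.val).Pairwise (· > ·) := List.pairwise_map.mpr ks.2
    have hlt : ∀ k ∈ ks.1.map Fin.val, k < n := by simp
    have : Absorbs (extendOne cs.simple) (fun _ ↦ cs.simple z) (fun _ ↦ ∅) n true (cs.simple i)
        (ks.1.map Fin.val) := by
      by_cases hi : (i : ℕ) = 0
      · rw [hx i hi]
        exact hrel.absorbs_last (ε' := true) (by omega) le_rfl hp hlt
      · rw [← extendOne_val cs.simple i]
        exact hrel.absorbs_simple (by omega) i.2 le_rfl hp hlt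
    simp only [wordProd, prod_map_normalWord cs.simple (cs.simple z) hx true]
    rcases this with ⟨ks', h₁, h₂, h₃⟩ | ⟨y, hy | ⟨j, hj₁, hj₂, rfl⟩, h₃⟩
    · obtain ⟨ls, rfl⟩ := exists_decreasingList_map_val h₁ h₂
      exact Or.inl ⟨ls, h₃⟩
    · exact absurd hy (Set.notMem_empty _)
    · refine Or.inr ⟨⟨j, hj₂⟩, by simpa using Nat.ne_of_gt hj₁, ?_⟩
      rwa [extendOne_of_lt _ hj₂] at h₃

/-- Height functions as a model of `D_{n + 1} / A_n`. -/
noncomputable def modelD (cs : CoxeterSystem (matD n) W) {z : Fin n} (hz : (z : ℕ) = 0) :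
    QuotientModel cs {i : Fin (n + 1) | (i : ℕ) ≠ 1} (DecreasingList n) (HeightFun n) where
  act := cs.lift ⟨flipD z, isLiftable_flipD hz⟩
  base := zero n
  rank := rank
  word ks := alternate (normalWord ks.1)
  point ks := ofList ks.1 ks.2
  empty := ⟨[], List.Pairwise.nil⟩
  word_empty := rfl
  act_word ks := by
    rw [wordProd, alternate_eq_alternateFrom, prod_map_alternateFrom_normalWord cs.simple
      (fun ε ↦ cs.simple (if ε then z.succ else 0)) rfl
      (fun i hi ↦ by rw [Fin.ext (hi.trans hz.symm)]; rfl) true]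
    refine act_normalProd _ _ _ (fun i hi x ↦ ?_) (fun i hi ε x hx ↦ ?_) _ _
    · rw [lift_apply_simple, flipD_succ]
      · rfl
      · rintro rfl
        exact hi hz
    · obtain rfl : i = z := Fin.ext (hi.trans hz.symm)
      rw [lift_apply_simple]
      cases ε
      · exact if_pos hx
      · rw [if_pos rfl, flipD_succ_self]
        exact if_pos hx
  rank_mono := rank_mono
  point_injective _ _ h := Subtype.ext (ofList_injective _ _ h)
  length_word ks := by rw [rank_ofList, length_alternate, length_normalWord]
  act_base j hj := by
    rw [lift_apply_simple]
    cases j using Fin.cases with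
    | zero =>
      -- The empty set has height 0 at 1, which is even, so t_0 does nothing.
      change flipMod 1 z (zero n) = zero n
      simp [flipMod]
    | succ j =>
      have hj₀ : (j : ℕ) ≠ 0 := by simpa using hj
      rw [flipD_succ (by rintro rfl; exact hj₀ hz)]
      refine flip_eq ?_
      obtain ⟨j | j, hj'⟩ := j
      · simp at hj₀
      · simp [flipValue]
  act_cases i x := by
    rw [lift_apply_simple]
    cases i using Fin.cases with
    | zero => exact flipMod_cases _ _ _
    | succ i =>
      by_cases h : i = z
      · rw [h, flipD_succ_self]
        exact flipMod_cases _ _ _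
      · rw [flipD_succ h]
        exact flip_cases _ _
  act_mono i x y := by
    rw [lift_apply_simple]
    cases i using Fin.cases with
    | zero => exact flipMod_mono
    | succ i =>
      by_cases h : i = z
      · rw [h, flipD_succ_self]
        exact flipMod_mono
      · rw [flipD_succ h]
        exact flip_mono
  exists_act_le x y h := by
    simp only [lift_apply_simple]
    obtain ⟨i, hi⟩ := exists_flip_le h
    by_cases hiz : i = z
    · subst hiz
      -- Exactly one of t_1 and t_0 performs the toggle, so type D has the same upward moves as type
      -- B.
      rcases Int.emod_two_eq_zero_or_one (x.val (i + 1)) with hx | hx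
      · refine ⟨i.succ, ?_⟩
        rw [flipD_succ_self]
        have : flipModEnd 0 i x = flip i x := if_pos hx
        rwa [this]
      · refine ⟨0, ?_⟩
        have : flipD i 0 x = flip i x := if_pos hx
        rwa [this]
    · refine ⟨i.succ, ?_⟩
      rwa [flipD_succ hiz]
  simple_mul_word i ks := by
    have hx (i : Fin n) (hi : (i : ℕ) = 0) : cs.simple i.succ = cs.simple z.succ := by
      rw [Fin.ext (hi.trans hz.symm)]
    have hrel := normalFormRelations_D cs hz
    have hp : (ks.1.map Fin.val).Pairwise (· > ·) := List.pairwise_map.mpr ks.2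
    have hlt : ∀ k ∈ ks.1.map Fin.val, k < n := by simp
    have : Absorbs (extendOne fun i ↦ cs.simple i.succ)
        (fun ε ↦ cs.simple (if ε then z.succ else 0))
        (fun ε ↦ {cs.simple (if !ε then z.succ else 0)}) n true (cs.simple i)
        (ks.1.map Fin.val) := by
      cases i using Fin.cases with
      | zero => exact hrel.absorbs_last (ε' := false) (by omega) le_rfl hp hlt
      | succ i =>
        by_cases hi : (i : ℕ) = 0
        · rw [hx i hi]
          exact hrel.absorbs_last (ε' := true) (by omega) le_rfl hp hlt
        · rw [← extendOne_val (fun i ↦ cs.simple i.succ) i]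
          exact hrel.absorbs_simple (by omega) i.2 le_rfl hp hlt
    simp only [wordProd, alternate_eq_alternateFrom, prod_map_alternateFrom_normalWord cs.simple
      (fun ε ↦ cs.simple (if ε then z.succ else 0)) rfl hx true]
    rcases this with ⟨ks', h₁, h₂, h₃⟩ | ⟨y, rfl | ⟨j, hj₁, hj₂, rfl⟩, h₃⟩
    · obtain ⟨ls, rfl⟩ := exists_decreasingList_map_val h₁ h₂
      exact Or.inl ⟨ls, h₃⟩
    · exact Or.inr ⟨0, by simp, h₃⟩
    · refine Or.inr ⟨(⟨j, hj₂⟩ : Fin n).succ, by simp; omega, ?_⟩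
      rwa [extendOne_of_lt _ hj₂] at h₃

end BruhatQuotient

/-! ### Relabelling of generators, and subsets of type A -/

namespace BruhatQuotient

open CoxeterSystem

section Relabelling

variable {B B' : Type*} {M : CoxeterMatrix B} {M' : CoxeterMatrix B'} {W : Type*} [Group W]
  {cs : CoxeterSystem M W} {cs' : CoxeterSystem M' W} {σ : B ≃ B'}

theorem wordProd_map_equiv (h : ∀ i, cs'.simple (σ i) = cs.simple i) (ω : List B) :
    cs'.wordProd (ω.map σ) = cs.wordProd ω := by
  simp [wordProd, Function.comp_def, h]

theorem simple_symm (h : ∀ i, cs'.simple (σ i) = cs.simple i) (i : B') :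
    cs.simple (σ.symm i) = cs'.simple i := by
  rw [← h, Equiv.apply_symm_apply]

theorem length_le_of_relabel (h : ∀ i, cs'.simple (σ i) = cs.simple i) (w : W) :
    cs'.length w ≤ cs.length w := by
  obtain ⟨ω, hω, rfl⟩ := cs.exists_isReduced w
  rw [hω.eq, ← wordProd_map_equiv h]
  simpa using cs'.length_wordProd_le (ω.map σ)

theorem length_eq_of_relabel (h : ∀ i, cs'.simple (σ i) = cs.simple i) (w : W) :
    cs'.length w = cs.length w :=
  (length_le_of_relabel h w).antisymm (length_le_of_relabel (simple_symm h) w)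

theorem isReflection_of_relabel (h : ∀ i, cs'.simple (σ i) = cs.simple i) {t : W}
    (ht : cs.IsReflection t) : cs'.IsReflection t := by
  obtain ⟨w, i, rfl⟩ := ht
  exact ⟨w, σ i, by rw [h]⟩

theorem bruhatStep_eq_of_relabel (h : ∀ i, cs'.simple (σ i) = cs.simple i) :
    BruhatStep cs' = BruhatStep cs := by
  ext u v
  simp only [BruhatStep, length_eq_of_relabel h]
  exact ⟨fun ⟨t, ht, h'⟩ ↦ ⟨t, isReflection_of_relabel (simple_symm h) ht, h'⟩,
    fun ⟨t, ht, h'⟩ ↦ ⟨t, isReflection_of_relabel h ht, h'⟩⟩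

theorem isMinRep_of_relabel (h : ∀ i, cs'.simple (σ i) = cs.simple i) {J : Set B} {w : W}
    (hw : IsMinRep cs J w) : IsMinRep cs' (σ '' J) w := by
  rintro ω _ hω hp ⟨j, hj, rfl⟩
  have hword : (ω.map σ.symm ++ [j]).map σ = ω ++ [σ j] := by simp [Function.comp_def]
  refine hw (ω.map σ.symm) j ?_ ?_ hj
  · rw [CoxeterSystem.IsReduced, ← wordProd_map_equiv h, hword, ← length_eq_of_relabel h, hω.eq]
    simp
  · rw [← wordProd_map_equiv h, hword, hp]

theorem isMinRep_iff_of_relabel (h : ∀ i, cs'.simple (σ i) = cs.simple i) {J : Set B} {w : W} :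
    IsMinRep cs J w ↔ IsMinRep cs' (σ '' J) w := by
  refine ⟨isMinRep_of_relabel h, fun hw ↦ ?_⟩
  simpa [← Set.image_comp] using isMinRep_of_relabel (simple_symm h) hw

/-- A relabelling of the generators does not affect the quotients. -/
def relabelOrderIso (h : ∀ i, cs'.simple (σ i) = cs.simple i) (J : Set B) :
    MinReps cs J ≃o MinReps cs' (σ '' J) where
  toEquiv := Equiv.subtypeEquivRight fun _ ↦ isMinRep_iff_of_relabel h
  map_rel_iff' {u v} := by
    change Relation.ReflTransGen (BruhatStep cs') u.1 v.1 ↔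
      Relation.ReflTransGen (BruhatStep cs) u.1 v.1
    rw [bruhatStep_eq_of_relabel h]

theorem exists_relabel (cs : CoxeterSystem M W) (σ : B ≃ B')
    (h : ∀ i j, M' (σ i) (σ j) = M i j) :
    ∃ cs' : CoxeterSystem M' W, ∀ i, cs'.simple (σ i) = cs.simple i := by
  have hM : M.reindex σ = M' := by
    ext i j
    change M (σ.symm i) (σ.symm j) = M' i j
    rw [← h, Equiv.apply_symm_apply, Equiv.apply_symm_apply]
  subst hM
  exact ⟨cs.reindex σ, fun i ↦ by simp⟩

end Relabelling

section TypeA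

variable {n : ℕ}

theorem A_apply_eq_three_iff {i j : Fin n} :
    CoxeterMatrix.A n i j = 3 ↔ (j : ℕ) + 1 = i ∨ (i : ℕ) + 1 = j := by
  simp only [CoxeterMatrix.A, Matrix.of_apply, Fin.ext_iff]
  grind

theorem A_apply_ne_four {i j : Fin n} : CoxeterMatrix.A n i j ≠ 4 := by
  simp only [CoxeterMatrix.A, Matrix.of_apply, Fin.ext_iff]
  grind

theorem exists_eq_compl_singleton {J : Set (Fin (n + 1))} (e : J ≃ Fin n) : ∃ p, J = {p}ᶜ := by
  have h₁ : J.ncard = n := by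
    rw [Set.ncard_def, Set.encard_congr (e.trans (Equiv.Set.univ _).symm)]
    simp
  have h₂ := Set.ncard_add_ncard_compl J
  rw [h₁, Nat.card_eq_fintype_card, Fintype.card_fin] at h₂
  obtain ⟨p, hp⟩ := Set.ncard_eq_one.mp (show Jᶜ.ncard = 1 by omega)
  exact ⟨p, by rw [← hp, compl_compl]⟩

theorem isTypeA_matB (hn : 3 ≤ n) : IsTypeA (matB n) {i : Fin n | (i : ℕ) ≠ 0} (n - 1) := by
  refine ⟨⟨fun i ↦ ⟨i.1 - 1, ?_⟩, fun j ↦ ⟨⟨j + 1, ?_⟩, ?_⟩, ?_, ?_⟩, ?_⟩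
  · omega
  · omega
  · simp
  · rintro ⟨i, hi : (i : ℕ) ≠ 0⟩
    simp only [Subtype.mk.injEq, Fin.ext_iff]
    omega
  · intro j
    simp
  · rintro ⟨i, hi : (i : ℕ) ≠ 0⟩ ⟨j, hj : (j : ℕ) ≠ 0⟩
    simp only [matB, CoxeterMatrix.A, Matrix.of_apply, Fin.ext_iff, Equiv.coe_fn_mk]
    grind

theorem isTypeA_matD (hn : 3 ≤ n) : IsTypeA (matD n) {i : Fin (n + 1) | (i : ℕ) ≠ 1} n := by
  -- The path is t_0 - t_2 - t_3 - ⋯ - t_n; truncated subtraction puts t_0 at position 0.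
  refine ⟨⟨fun i ↦ ⟨i.1 - 1, ?_⟩, fun j ↦ ⟨⟨if (j : ℕ) = 0 then 0 else j + 1, ?_⟩, ?_⟩, ?_, ?_⟩, ?_⟩
  · omega
  · split_ifs <;> omega
  · simp only [Set.mem_ofPred_eq]
    split_ifs <;> omega
  · rintro ⟨i, hi : (i : ℕ) ≠ 1⟩
    simp only [Subtype.mk.injEq, Fin.ext_iff]
    split_ifs <;> omega
  · intro j
    simp only [Fin.ext_iff]
    split_ifs <;> omega
  · rintro ⟨i, hi : (i : ℕ) ≠ 1⟩ ⟨j, hj : (j : ℕ) ≠ 1⟩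
    simp only [matD, CoxeterMatrix.A, Matrix.of_apply, Fin.ext_iff, Equiv.coe_fn_mk]
    grind

theorem IsTypeA.exists_position {B : Type*} {M : CoxeterMatrix B} {J : Set B} {r : ℕ}
    (h : IsTypeA M J r) : ∃ c : B → ℕ, (∀ i ∈ J, c i < r) ∧ (∀ i ∈ J, ∀ j ∈ J, c i = c j → i = j) ∧
      (∀ k < r, ∃ i ∈ J, c i = k) ∧ ∀ i ∈ J, ∀ j ∈ J,
        M i j ≠ 4 ∧ (M i j = 3 ↔ c j + 1 = c i ∨ c i + 1 = c j) := by
  classical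
  obtain ⟨e, he⟩ := h
  have hc (i : B) (hi : i ∈ J) : (if h : i ∈ J then (e ⟨i, h⟩ : ℕ) else 0) = e ⟨i, hi⟩ := by
    rw [dif_pos hi]
  refine ⟨fun i ↦ if h : i ∈ J then (e ⟨i, h⟩ : ℕ) else 0, fun i hi ↦ ?_, fun i hi j hj hij ↦ ?_,
    fun k hk ↦ ⟨e.symm ⟨k, hk⟩, Subtype.coe_prop _, ?_⟩, fun i hi j hj ↦ ?_⟩
  · simp only [hc i hi]
    exact (e ⟨i, hi⟩).2
  · simp only [hc i hi, hc j hj] at hij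
    exact congrArg Subtype.val (e.injective (Fin.ext hij))
  · simp
  · simp only [hc i hi, hc j hj]
    rw [he ⟨i, hi⟩ ⟨j, hj⟩]
    exact ⟨A_apply_ne_four, A_apply_eq_three_iff⟩

/-- Exactly one node is missing. If it is s_2, then s_1 is isolated, which is impossible in a path
with at least two nodes; if it is neither s_1 nor s_2, the label 4 survives. -/
theorem eq_of_isTypeA_matB (hn : 3 ≤ n) {J : Set (Fin n)} (h : IsTypeA (matB n) J (n - 1)) :
    J = {i : Fin n | (i : ℕ) ≠ 0} := by
  obtain ⟨n, rfl⟩ : ∃ m, n = m + 1 := ⟨n - 1, by omega⟩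
  obtain ⟨c, hlt, -, hsurj, hM⟩ := h.exists_position
  obtain ⟨p, rfl⟩ := exists_eq_compl_singleton h.choose
  have hmem (i : Fin (n + 1)) : i ∈ ({p}ᶜ : Set (Fin (n + 1))) ↔ (i : ℕ) ≠ p := by
    simp [Fin.ext_iff]
  suffices (p : ℕ) = 0 by
    ext i
    rw [hmem, this]
    rfl
  by_contra hp
  have h₀ := (hmem ⟨0, by omega⟩).mpr (Ne.symm hp)
  by_cases hp₁ : (p : ℕ) = 1
  · obtain ⟨j, hj, hc⟩ := hsurj
      (if c ⟨0, by omega⟩ = 0 then 1 else c ⟨0, by omega⟩ - 1) (by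
        have := hlt _ h₀
        split_ifs <;> omega)
    have h₃ := (hM _ h₀ _ hj).2.mpr (by rw [hc]; split_ifs <;> omega)
    simp only [matB, Matrix.of_apply, Fin.ext_iff] at h₃
    rw [hmem] at hj
    grind
  · exact (hM _ h₀ _ ((hmem ⟨1, by omega⟩).mpr (Ne.symm hp₁))).1 (matB_zero_one rfl rfl)

theorem matD_eq_three_iff {i j : Fin (n + 1)} : matD n i j = 3 ↔
    ((i : ℕ) = 0 ∧ (j : ℕ) = 2) ∨ ((i : ℕ) = 2 ∧ (j : ℕ) = 0) ∨
      (1 ≤ (i : ℕ) ∧ (i : ℕ) + 1 = j) ∨ (1 ≤ (j : ℕ) ∧ (j : ℕ) + 1 = i) := by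
  simp only [matD, Matrix.of_apply, Fin.ext_iff]
  grind

/-- If t_0 and t_1 both remain, they are the two ends of the path and share the neighbour t_2. So
the path has three nodes, and the missing one is t_3. -/
theorem eq_of_isTypeA_matD (hn : 3 ≤ n) {K : Set (Fin (n + 1))} (h : IsTypeA (matD n) K n) :
    ∃ p : Fin (n + 1), K = {p}ᶜ ∧ ((p : ℕ) = 0 ∨ (p : ℕ) = 1 ∨ (n = 3 ∧ (p : ℕ) = 3)) := by
  obtain ⟨c, hlt, hinj, hsurj, hM⟩ := h.exists_position
  obtain ⟨p, rfl⟩ := exists_eq_compl_singleton h.choose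
  refine ⟨p, rfl, ?_⟩
  have hmem (i : Fin (n + 1)) : i ∈ ({p}ᶜ : Set (Fin (n + 1))) ↔ (i : ℕ) ≠ p := by
    simp [Fin.ext_iff]
  by_contra! hp
  obtain ⟨hp₀, hp₁, hp₃⟩ := hp
  have h₀ := (hmem ⟨0, by omega⟩).mpr hp₀.symm
  have h₁ := (hmem ⟨1, by omega⟩).mpr hp₁.symm
  have hne₀₁ : c ⟨0, by omega⟩ ≠ c ⟨1, by omega⟩ := fun h' ↦ by simpa using hinj _ h₀ _ h₁ h'
  -- a vertex whose only possible neighbour is `t_2` is an end of the path next to `t_2`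
  have hend (i : Fin (n + 1)) (hi : i ∈ ({p}ᶜ : Set (Fin (n + 1)))) (hi' : (i : ℕ) < 2) :
      (p : ℕ) ≠ 2 ∧ ((c i = 0 ∧ c ⟨2, by omega⟩ = 1) ∨
        (c i + 1 = n ∧ c ⟨2, by omega⟩ + 1 = c i)) := by
    have hnb (k : ℕ) (hk : k < n) (hk' : k + 1 = c i ∨ c i + 1 = k) :
        (p : ℕ) ≠ 2 ∧ c ⟨2, by omega⟩ = k := by
      obtain ⟨j, hj, rfl⟩ := hsurj k hk
      have h₃ := matD_eq_three_iff.mp ((hM i hi j hj).2.mpr hk')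
      have hj₂ : j = ⟨2, by omega⟩ := Fin.ext (by simp only; omega)
      rw [hmem] at hj
      rw [← hj₂]
      refine ⟨?_, rfl⟩
      rw [hj₂] at hj
      exact hj.symm
    have hci := hlt i hi
    by_cases hc : c i = 0
    · have := hnb 1 (by omega) (by omega)
      omega
    · have h' := hnb (c i - 1) (by omega) (by omega)
      by_cases hc' : c i + 1 = n
      · omega
      · have := hnb (c i + 1) (by omega) (by omega)
        omega
  have he₀ := hend _ h₀ (by simp)
  have he₁ := hend _ h₁ (by simp)
  have h₂ := (hmem ⟨2, by omega⟩).mpr he₀.1.symm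
  -- The common neighbour of the two ends has position 1 and n - 2, so n = 3, which `hp₃` excludes
  -- when t_3 is missing. If t_3 is present, it is a third neighbour of t_2.
  by_cases hp₃' : (p : ℕ) = 3
  · omega
  · have h₃ := (hmem ⟨3, by omega⟩).mpr (Ne.symm hp₃')
    have h₄ := (hM _ h₂ _ h₃).2.mp (matD_eq_three_iff.mpr (by simp))
    have hne₀ : c ⟨0, by omega⟩ ≠ c ⟨3, by omega⟩ := fun h' ↦ by simpa using hinj _ h₀ _ h₃ h'
    have hne₁ : c ⟨1, by omega⟩ ≠ c ⟨3, by omega⟩ := fun h' ↦ by simpa using hinj _ h₁ _ h₃ h'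
    have := hlt _ h₃
    omega

end TypeA

end BruhatQuotient

/-! ### Graph automorphisms of D_{n+1} and the main theorem -/

namespace BruhatQuotient

section Main

variable {n : ℕ} {W : Type*} [Group W]

theorem matD_ne_eq_two_or_three {i j : Fin (n + 1)} (h : i ≠ j) :
    matD n i j = 2 ∨ matD n i j = 3 := by
  simp only [matD, Matrix.of_apply, if_neg h]
  split_ifs <;> simp

theorem matD_swap_zero_one (i j : Fin (n + 1)) (h : 3 ≤ n) :
    matD n (Equiv.swap ⟨1, by omega⟩ 0 i) (Equiv.swap ⟨1, by omega⟩ 0 j) = matD n i j := by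
  have hval (i : Fin (n + 1)) : (Equiv.swap (⟨1, by omega⟩ : Fin (n + 1)) 0 i).val =
      if (i : ℕ) = 1 then 0 else if (i : ℕ) = 0 then 1 else i.val := by
    simp only [Equiv.swap_apply_def, Fin.ext_iff]
    rw [apply_ite Fin.val, apply_ite Fin.val]
    rfl
  have h₃ : matD n (Equiv.swap ⟨1, by omega⟩ 0 i) (Equiv.swap ⟨1, by omega⟩ 0 j) = 3 ↔
      matD n i j = 3 := by
    rw [matD_eq_three_iff, matD_eq_three_iff, hval, hval]
    generalize (i : ℕ) = a
    generalize (j : ℕ) = b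
    split_ifs <;> simp_all <;> omega
  by_cases hij : i = j
  · rw [hij, (matD n).diagonal, (matD n).diagonal]
  · have h₁ := matD_ne_eq_two_or_three hij
    have h₂ := matD_ne_eq_two_or_three
      ((Equiv.swap (⟨1, by omega⟩ : Fin (n + 1)) 0).injective.ne hij)
    omega

theorem matD_three_swap (i j : Fin 4) :
    matD 3 (Equiv.swap 1 3 i) (Equiv.swap 1 3 j) = matD 3 i j := by
  fin_cases i <;> fin_cases j <;> rfl

/-- An automorphism of the Coxeter graph moves the missing node to t_1: the swap of t_0 and t_1, or
for D_4 also that of t_1 and t_3. Renaming the generators of the same group changes neither lengths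
nor reflections. -/
theorem nonempty_minReps_orderIso_of_isTypeA (hn : 3 ≤ n) (cs : CoxeterSystem (matD n) W)
    {K : Set (Fin (n + 1))} (hK : IsTypeA (matD n) K n) :
    ∃ cs' : CoxeterSystem (matD n) W,
      Nonempty (MinReps cs' {i : Fin (n + 1) | (i : ℕ) ≠ 1} ≃o MinReps cs K) := by
  obtain ⟨p, rfl, hp⟩ := eq_of_isTypeA_matD hn hK
  have hσ : ∃ σ : Equiv.Perm (Fin (n + 1)), (∀ i j, matD n (σ i) (σ j) = matD n i j) ∧
      (σ p : ℕ) = 1 := by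
    rcases hp with hp | hp | ⟨rfl, hp⟩
    · refine ⟨Equiv.swap ⟨1, by omega⟩ 0, fun i j ↦ matD_swap_zero_one i j hn, ?_⟩
      rw [Fin.ext (a := p) (b := 0) hp, Equiv.swap_apply_right]
    · exact ⟨Equiv.refl _, fun _ _ ↦ rfl, hp⟩
    · refine ⟨Equiv.swap 1 3, matD_three_swap, ?_⟩
      rw [Fin.ext (a := p) (b := 3) hp, Equiv.swap_apply_right]
      rfl
  obtain ⟨σ, hσ, hσp⟩ := hσ
  obtain ⟨cs', hcs⟩ := exists_relabel cs σ hσ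
  refine ⟨cs', ⟨?_⟩⟩
  have himage : σ '' {p}ᶜ = {i : Fin (n + 1) | (i : ℕ) ≠ 1} := by
    rw [Set.image_compl_eq σ.bijective, Set.image_singleton]
    ext i
    simp [Fin.ext_iff, hσp]
  rw [← himage]
  exact (relabelOrderIso hcs _).symm

theorem QuotientModel.existsUnique {B : Type*} {M : CoxeterMatrix B} {cs : CoxeterSystem M W}
    {J : Set B} {X : Type*} [PartialOrder X] (m : QuotientModel cs J (DecreasingList n) X)
    (w : MinReps cs J) {word : List (Fin n) → List B} (hword : ∀ ks, m.word ks = word ks.1) :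
    ∃! ks : List (Fin n), ks.Pairwise (· > ·) ∧ w.1 = cs.wordProd (word ks) := by
  obtain ⟨ks, rfl⟩ := m.equivMinReps.surjective w
  refine ⟨ks.1, ⟨ks.2, by rw [← hword]; rfl⟩, fun ls ⟨hls, h⟩ ↦ ?_⟩
  rw [← hword ⟨ls, hls⟩] at h
  exact congrArg Subtype.val (m.wordProd_word_injective h).symm

end Main

end BruhatQuotient

open BruhatQuotient in
theorem mainTheorem7 (n : ℕ) (hn : 3 ≤ n)
    {W U : Type*} [Group W] [Group U]
    (csB : CoxeterSystem (matB n) W) (csD : CoxeterSystem (matD n) U) :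
    -- `B_n / A_{n-1} ≅ D_{n+1} / A_n`, for all parabolic subgroups of these types
    (∀ (J : Set (Fin n)) (K : Set (Fin (n + 1))),
      IsTypeA (matB n) J (n - 1) → IsTypeA (matD n) K n →
        Nonempty (MinReps csB J ≃o MinReps csD K)) ∧
    -- for `J = {s_2, …, s_n}` and `K = {t_0, t_2, …, t_n}`:
    (∀ (J : Set (Fin n)) (K : Set (Fin (n + 1))),
      J = {i : Fin n | (i : ℕ) ≠ 0} → K = {i : Fin (n + 1) | (i : ℕ) ≠ 1} →
        -- `J` and `K` are of the types above
        IsTypeA (matB n) J (n - 1) ∧ IsTypeA (matD n) K n ∧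
        -- the words with `k_1 > ⋯ > k_m` are reduced expressions of elements of `W^J`, `U^K`
        (∀ ks : List (Fin n), ks.Pairwise (· > ·) →
          (csB.IsReduced (normalWord ks) ∧ IsMinRep csB J (csB.wordProd (normalWord ks))) ∧
          (csD.IsReduced (alternate (normalWord ks)) ∧
            IsMinRep csD K (csD.wordProd (alternate (normalWord ks))))) ∧
        -- every element of `W^J`, `U^K` has exactly one such expression
        (∀ w : MinReps csB J, ∃! ks : List (Fin n),
          ks.Pairwise (· > ·) ∧ w.1 = csB.wordProd (normalWord ks)) ∧
        (∀ u : MinReps csD K, ∃! ks : List (Fin n),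
          ks.Pairwise (· > ·) ∧ u.1 = csD.wordProd (alternate (normalWord ks))) ∧
        -- the resulting bijection is an isomorphism of posets
        ∃ f : MinReps csB J ≃o MinReps csD K,
          ∀ (w : MinReps csB J) (ks : List (Fin n)), ks.Pairwise (· > ·) →
            w.1 = csB.wordProd (normalWord ks) →
              (f w).1 = csD.wordProd (alternate (normalWord ks))) := by
  have hz : ((⟨0, by omega⟩ : Fin n) : ℕ) = 0 := rfl
  -- Both models send a decreasing list to the same height function; this is the whole comparison of
  -- the two types.
  have hpoint (cs : CoxeterSystem (matD n) U) : (modelB csB hz).point = (modelD cs hz).point := rfl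
  refine ⟨fun J K hJ hK ↦ ?_, ?_⟩
  · obtain rfl := eq_of_isTypeA_matB hn hJ
    obtain ⟨csD', ⟨f⟩⟩ := nonempty_minReps_orderIso_of_isTypeA hn csD hK
    exact ⟨((modelB csB hz).orderIso (modelD csD' hz) (hpoint csD')).trans f⟩
  · rintro J K rfl rfl
    refine ⟨isTypeA_matB hn, isTypeA_matD hn, fun ks hks ↦ ?_, fun w ↦ ?_, fun u ↦ ?_,
      (modelB csB hz).orderIso (modelD csD hz) (hpoint csD), fun w ks hks hw ↦ ?_⟩
    · exact ⟨⟨(modelB csB hz).isReduced_word ⟨ks, hks⟩, (modelB csB hz).isMinRep_word ⟨ks, hks⟩⟩,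
        (modelD csD hz).isReduced_word ⟨ks, hks⟩, (modelD csD hz).isMinRep_word ⟨ks, hks⟩⟩
    · exact (modelB csB hz).existsUnique w fun _ ↦ rfl
    · exact (modelD csD hz).existsUnique u fun _ ↦ rfl
    · obtain rfl : w = (modelB csB hz).equivMinReps ⟨ks, hks⟩ := Subtype.ext hw
      rw [QuotientModel.orderIso_equivMinReps]
      rfl
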